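/- Let $F$ be a field of characteristic different from $2$ and $3$, let $\bar F$ be a separable closure of $F$ with Galois group $\bar G=\mathrm{Gal}(\bar F/F)$, and let $\rho\in\bar F$ be a primitive third root of unity. Let $\mathcal I$ be the set of nine-point subsets $I\subset\mathbb P^2(\bar F)$ that are the set of inflection points of a smooth plane cubic over $\bar F$. Let $\mathcal S$ be the set of nine-element subgroups $S\subset \mathrm{PGL}_3(\bar F)$ that are the image of a subgroup $\tilde S\subset\mathrm{GL}_3(\bar F)$ generated by two elements $\tilde x,\tilde y$ with $\tilde x^3=1$, $\tilde y^3=1$ and $\tilde x\tilde y=\rho\,\tilde y\tilde x$. For $I\in\mathcal I$, call three points of $I$ collinear if they are distinct and lie on a line, or are all equal. Let $E(I)$ be the set of classes of pairs $(P,Q)\in I\times I$ under the relation $(P,Q)\sim(R,S)$ if there is $T\in I$ such that $P,S,T$ are collinear and $R,Q,T$ are collinear. The stabilizer $H_I$ of $I$ in $\mathrm{PGL}_3(\bar F)$ acts on $E(I)$; let $S_I\subset H_I$ be the kernel of this action. Then: 1. $I\mapsto S_I$ is a bijection from $\mathcal I$ onto $\mathcal S$. Its inverse is as follows: if $x,y\in\mathrm{PGL}_3(\bar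 F)$ generate $S_I$, then $I$ is the set of points lying both on a line preserved by $x$ and on a line preserved by $y$. 2. The bijection commutes with the action of $\bar G$: for $\sigma\in\bar G$ the action of $\sigma$ maps $\mathcal I$ to $\mathcal I$ and $\mathcal S$ to $\mathcal S$, and $S_{\sigma(I)}=\sigma(S_I)$. This holds for the coordinatewise action of $\bar G$. It also holds for the action defined by any central simple algebra $A/F$ of degree three and any isomorphism $\theta:\bar F\otimes_F A\cong M_3(\bar F)$ of $\bar F$-algebras: there $\sigma$ acts on $M_3(\bar F)$, and so on $\mathrm{PGL}_3(\bar F)$, as $\theta\circ(\sigma\otimes 1)\circ\theta^{-1}$, and on $\mathbb P^2(\bar F)$ by identifying a point, that is, a line $L\subset \bar F^3$, with the minimal right ideal of $M_3(\bar F)$ of matrices with range in $L$. 3. For every $I\in\mathcal I$, the stabilizer $H_I$ of $I$ in $\mathrm{PGL}_3(\bar F)$ is the normalizer of $S_I$ in $\mathrm{PGL}_3(\bar F)$. -/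

import Mathlib

open scoped LinearAlgebra.Projectivization MatrixGroups TensorProduct Pointwise

namespace InflectionSets

/-- The set of `K`-points of the projective plane. -/
abbrev Plane (K : Type*) [Field K] : Type _ := ℙ K (Fin 3 → K)

/-! ### Smooth plane cubics and their inflection points -/

/-- `f` is a ternary cubic form whose curve `f = 0` is smooth, that is, has no singular point with
coordinates in an algebraic closure of `K`. (The zero form is excluded automatically.) -/
def IsSmoothCubic {K : Type*} [Field K] (f : MvPolynomial (Fin 3) K) : Prop :=
  f.IsHomogeneous 3 ∧ ∀ v : Fin 3 → AlgebraicClosure K, v ≠ 0 → MvPolynomial.aeval v f = 0 →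
    ∃ i, MvPolynomial.aeval v (MvPolynomial.pderiv i f) ≠ 0

/-- The polynomial `f (v + t w)` in the variable `t`: the restriction of `f` to the line through
`v` and `w`, in the affine parameter `t` of that line at `v`. -/
noncomputable def restrictToLine {K : Type*} [Field K] (f : MvPolynomial (Fin 3) K)
    (v w : Fin 3 → K) : Polynomial K :=
  MvPolynomial.aeval (fun i => Polynomial.C (v i) + Polynomial.X * Polynomial.C (w i)) f

/-- The inflection points of the curve `f = 0`: the points `P` of the curve at which the tangent
line, consisting of the `w` with `∑ i, ∂ᵢf(P) wᵢ = 0`, meets the curve with multiplicity at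
least three. -/
def inflectionPoints {K : Type*} [Field K] (f : MvPolynomial (Fin 3) K) : Set (Plane K) :=
  {P | MvPolynomial.eval P.rep f = 0 ∧
    ∀ w : Fin 3 → K, ∑ i, MvPolynomial.eval P.rep (MvPolynomial.pderiv i f) * w i = 0 →
      Polynomial.X ^ 3 ∣ restrictToLine f P.rep w}

/-- The nine-point subsets of the plane that are the set of inflection points of a smooth cubic. -/
def inflectionSets (K : Type*) [Field K] : Set (Set (Plane K)) :=
  {I | I.ncard = 9 ∧ ∃ f : MvPolynomial (Fin 3) K, IsSmoothCubic f ∧ I = inflectionPoints f}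

/-! ### The nine-point Jacobian `E(I)` and the group attached to `I` -/

/-- The collinearity relation used on `I`: three distinct points on a line, or three equal
points. -/
def Col {K : Type*} [Field K] (P Q R : Plane K) : Prop :=
  (P ≠ Q ∧ Q ≠ R ∧ P ≠ R ∧ Projectivization.IsCollinear {P, Q, R}) ∨ (P = Q ∧ Q = R)

/-- `(P, Q) ∼ (R, S)` if there is one `T` in `I` such that `P, S, T` and `R, Q, T` are collinear. -/
def PairRel {K : Type*} [Field K] (I : Set (Plane K)) (a b : I × I) : Prop :=
  ∃ T : I, Col (a.1 : Plane K) b.2 T ∧ Col (b.1 : Plane K) a.2 T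

/-- The set `E(I)` of equivalence classes of pairs of points of `I`. -/
def E {K : Type*} [Field K] (I : Set (Plane K)) : Type _ := Quot (PairRel I)

theorem isCollinear_smul {K : Type*} [Field K] (φ : PGL(3, K)) {s : Set (Plane K)}
    (h : Projectivization.IsCollinear s) : Projectivization.IsCollinear (φ • s) := by
  obtain ⟨M, hfin, hM, hs⟩ := h
  induction φ using Matrix.ProjGenLinGroup.induction_on with
  | mk g =>
    let e : (Fin 3 → K) ≃ₗ[K] (Fin 3 → K) := DistribMulAction.toLinearEquiv K (Fin 3 → K) g
    refine ⟨(M.submodule.map e.toLinearMap).projectivization, ?_, ?_, ?_⟩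
    · rw [Projectivization.Subspace.submodule.apply_symm_apply]
      infer_instance
    · rw [Projectivization.Subspace.submodule.apply_symm_apply]
      exact (LinearEquiv.finrank_map_eq e M.submodule).trans_le hM
    · rintro _ ⟨P, hP, rfl⟩
      have hP' := hs hP
      induction P using Projectivization.ind with
      | h v hv =>
        simp only [Projectivization.PGL.mk_smul_mk, SetLike.mem_coe,
          Submodule.mk_mem_projectivization_iff]
        refine ⟨v, ?_, rfl⟩
        exact (Projectivization.Subspace.mem_submodule_iff M hv).mpr hP'

theorem Col.smul {K : Type*} [Field K] (φ : PGL(3, K)) {P Q R : Plane K} (h : Col P Q R) :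
    Col (φ • P) (φ • Q) (φ • R) := by
  rcases h with ⟨h1, h2, h3, h4⟩ | ⟨rfl, rfl⟩
  · refine Or.inl ⟨by simpa using h1, by simpa using h2, by simpa using h3, ?_⟩
    simpa [Set.smul_set_insert] using isCollinear_smul φ h4
  · exact Or.inr ⟨rfl, rfl⟩

/-- The induced action of the stabilizer `H` of `I` on `E(I)`,
`φ {(P, Q)} = {(φ P, φ Q)}`. -/
instance stabilizerActionE {K : Type*} [Field K] (I : Set (Plane K)) :
    MulAction (MulAction.stabilizer PGL(3, K) I) (E I) where
  smul φ := Quot.map (fun a => (φ • a.1, φ • a.2)) (by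
    rintro a b ⟨T, h1, h2⟩
    exact ⟨φ • T, h1.smul (φ : PGL(3, K)), h2.smul (φ : PGL(3, K))⟩)
  one_smul := by
    rintro ⟨a⟩
    exact congrArg (Quot.mk _) (Prod.ext (one_smul _ a.1) (one_smul _ a.2))
  mul_smul φ ψ := by
    rintro ⟨a⟩
    exact congrArg (Quot.mk _) (Prod.ext (mul_smul φ ψ a.1) (mul_smul φ ψ a.2))

/-- The subgroup `S` of `PGL₃` attached to `I`: the kernel of the action on `E(I)` of the
stabilizer of `I`. -/
def translationGroup {K : Type*} [Field K] (I : Set (Plane K)) : Subgroup PGL(3, K) :=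
  (MulAction.toPermHom (MulAction.stabilizer PGL(3, K) I) (E I)).ker.map
    (MulAction.stabilizer PGL(3, K) I).subtype

/-! ### The subgroups of `PGL₃` that lift to Heisenberg groups, and their points -/

/-- The nine-element subgroups of `PGL₃` that are the image of a subgroup of `GL₃` generated by
some `x`, `y` with `x³ = 1`, `y³ = 1` and `x y = ρ y x`. -/
def heisenbergSubgroups {K : Type*} [Field K] (ρ : K) : Set (Subgroup PGL(3, K)) :=
  {S | Nat.card S = 9 ∧ ∃ x y : GL (Fin 3) K, x ^ 3 = 1 ∧ y ^ 3 = 1 ∧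
    (x * y : Matrix (Fin 3) (Fin 3) K) = ρ • (y * x : Matrix (Fin 3) (Fin 3) K) ∧
    S = (Subgroup.closure {x, y}).map Matrix.ProjGenLinGroup.mk}

/-- The union of the lines of the plane preserved by `x`. A line is given by a two-dimensional
subspace `W` of `K³`. -/
def onInvariantLine {K : Type*} [Field K] (x : PGL(3, K)) : Set (Plane K) :=
  {P | ∃ W : Submodule K (Fin 3 → K), Module.finrank K W = 2 ∧
    (∀ Q ∈ W.projectivization, x • Q ∈ W.projectivization) ∧ P ∈ W.projectivization}

/-! ### Galois actions -/

/-- A ring automorphism of `M₃(K)` acts on `PGL₃(K)`, through its action on `GL₃(K) = M₃(K)ˣ`. -/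
def pglMap {K : Type*} [Field K]
    (τ : Matrix (Fin 3) (Fin 3) K ≃+* Matrix (Fin 3) (Fin 3) K) : PGL(3, K) →* PGL(3, K) :=
  QuotientGroup.map (Subgroup.center (GL (Fin 3) K)) (Subgroup.center (GL (Fin 3) K))
    (Units.mapEquiv τ.toMulEquiv).toMonoidHom (by
      intro z hz
      rw [Subgroup.mem_comap, Subgroup.mem_center_iff]
      intro g
      obtain ⟨g, rfl⟩ := (Units.mapEquiv τ.toMulEquiv).surjective g
      have h := congrArg (Units.mapEquiv τ.toMulEquiv) (Subgroup.mem_center_iff.mp hz g)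
      simpa using h)

/-- The coordinatewise action of a field automorphism `σ` on the plane. -/
def planeMap {F K : Type*} [Field F] [Field K] [Algebra F K] (σ : Gal(K/F)) :
    Plane K → Plane K :=
  Projectivization.map (σ := ((σ : K ≃+* K) : K →+* K))
    { toFun := fun v i => σ (v i)
      map_add' := fun v w => funext fun i => map_add σ (v i) (w i)
      map_smul' := fun c v => funext fun i => map_mul σ c (v i) }
    (fun _ _ h => funext fun i => σ.injective (congrFun h i))

/-- The action of `σ` on `M₃(K)` obtained from its action on the first factor of `K ⊗ A` through
an identification `θ` of `K ⊗ A` with `M₃(K)`. -/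
def twist {F K A : Type*} [Field F] [Field K] [Algebra F K] [Ring A] [Algebra F A]
    (θ : K ⊗[F] A ≃ₐ[K] Matrix (Fin 3) (Fin 3) K) (σ : Gal(K/F)) :
    Matrix (Fin 3) (Fin 3) K ≃+* Matrix (Fin 3) (Fin 3) K :=
  (θ.symm.toRingEquiv.trans
    (Algebra.TensorProduct.congr σ (AlgEquiv.refl : A ≃ₐ[F] A)).toRingEquiv).trans θ.toRingEquiv

/-- The minimal right ideal of `M₃(K)` corresponding to a point `P` of the plane: the matrices
whose range is contained in the line `P ⊆ K³`. -/
def rightIdeal {K : Type*} [Field K] (P : Plane K) : Set (Matrix (Fin 3) (Fin 3) K) :=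
  {M | ∀ v : Fin 3 → K, M.mulVec v ∈ P.submodule}

/-- The action on sets of points of the plane induced by an automorphism of the ring `M₃(K)`, when
points are seen as minimal right ideals of `M₃(K)`. -/
def idealImage {K : Type*} [Field K]
    (τ : Matrix (Fin 3) (Fin 3) K ≃+* Matrix (Fin 3) (Fin 3) K) (I : Set (Plane K)) :
    Set (Plane K) :=
  {Q | ∃ P ∈ I, rightIdeal Q = τ '' rightIdeal P}

end InflectionSets

namespace InflectionSets

/-! All inflection sets form a single orbit under `PGL₃`, so every assertion reduces to one model:
the nine points `xyz = 0`, `x³ + y³ + z³ = 0` of the Fermat cubic (`hessePoints`).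

For the single orbit (`exists_eq_smul_hessePoints`), move two inflection points to standard
position. Straightening their tangents brings the cubic to the form `xyℓ + κz³`, where the line `z =
0` passes through three inflection points and `x`, `y`, `ℓ` are their tangents. Factoring `a³ + b³ +
c³ - 3abc` over `ρ` then turns it into a member of the Hesse pencil `r(x³ + y³ + z³ + mxyz)`. All
members of this pencil contain the nine model points among their inflection points, and a
nine-element set leaves no room for others.

On the model, the points carry labels in `(ℤ/3)²` such that collinearity, in the sense of `Col`,
means that the labels sum to zero (`col_hessePt_iff`). Hence `E(I)` is the group of differences of
labels, and the kernel of the action consists of the translations, which are realised by the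
Heisenberg matrices (`mem_translationGroup_hessePoints`). Conversely, any Heisenberg pair in `GL₃`
is conjugate to the standard one (`exists_conj_heisGL`), so the Heisenberg subgroups are exactly the
conjugates of the model group.

The points are recovered from the group as those on an invariant line of each element
(`smul_hessePoints_eq`). This gives injectivity and, with equivariance under conjugation, the
normalizer statement. For the Galois part, a semilinear automorphism of `M₃` is the coordinatewise
action followed by a conjugation, by Skolem–Noether, and the coordinatewise action fixes the model.
-/

section

/-! ### Inflection points and smoothness under linear substitution -/

open MvPolynomial

/-- The chain rule for a derivation and a polynomial substitution. -/
theorem derivation_aeval {R B M ι : Type*} [CommRing R] [CommRing B] [Algebra R B]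
    [AddCommGroup M] [Module R M] [Module B M] [IsScalarTower R B M] [Fintype ι]
    (D : Derivation R B M) (q : ι → B) (f : MvPolynomial ι R) :
    D (aeval q f) = ∑ j, aeval q (pderiv j f) • D (q j) := by
  induction f using MvPolynomial.induction_on with
  | C a => simp
  | add p r hp hr => simp [hp, hr, add_smul, Finset.sum_add_distrib]
  | mul_X p i hp =>
    classical
    simp only [map_mul, aeval_X, Derivation.leibniz, hp, pderiv_X, smul_eq_mul, map_add,
      add_smul, Finset.sum_add_distrib, mul_smul, Finset.smul_sum]
    congr 1
    rw [Finset.sum_eq_single i]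
    · simp
    · intro j _ hj
      simp [hj.symm]
    · simp

/-- The polynomial `f ∘ g` for a linear map `g`. -/
noncomputable def linSubst {K : Type*} [Field K] (g : Matrix (Fin 3) (Fin 3) K)
    (f : MvPolynomial (Fin 3) K) : MvPolynomial (Fin 3) K :=
  aeval (fun i => ∑ j, C (g i j) * X j) f

variable {K : Type*} [Field K]

theorem aeval_linSubst {L : Type*} [CommRing L] [Algebra K L] (g : Matrix (Fin 3) (Fin 3) K)
    (f : MvPolynomial (Fin 3) K) (v : Fin 3 → L) :
    aeval v (linSubst g f) = aeval (fun i => ∑ j, algebraMap K L (g i j) * v j) f := by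
  have h : (aeval v).comp (aeval (fun i => ∑ j, C (g i j) * X j)) =
      aeval (R := K) (fun i => ∑ j, algebraMap K L (g i j) * v j) := by
    ext i
    simp
  exact DFunLike.congr_fun h f

theorem eval_linSubst (g : Matrix (Fin 3) (Fin 3) K)
    (f : MvPolynomial (Fin 3) K) (v : Fin 3 → K) :
    eval v (linSubst g f) = eval (g.mulVec v) f := by
  have := aeval_linSubst g f v
  simpa [Matrix.mulVec, dotProduct, aeval_eq_eval] using! this

theorem restrictToLine_linSubst (g : Matrix (Fin 3) (Fin 3) K)
    (f : MvPolynomial (Fin 3) K) (v w : Fin 3 → K) :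
    restrictToLine (linSubst g f) v w = restrictToLine f (g.mulVec v) (g.mulVec w) := by
  unfold restrictToLine
  rw [aeval_linSubst]
  congr 2
  ext1 i
  simp only [Matrix.mulVec, dotProduct, map_sum, map_mul, Finset.mul_sum,
    ← Finset.sum_add_distrib, Polynomial.algebraMap_eq]
  exact Finset.sum_congr rfl fun j _ => by ring

theorem restrictToLine_coeff_zero (f : MvPolynomial (Fin 3) K) (v w : Fin 3 → K) :
    (restrictToLine f v w).coeff 0 = eval v f := by
  have h : ((Polynomial.aeval (R := K) (0 : K)).comp (aeval (R := K)
      (fun i => Polynomial.C (v i) + Polynomial.X * Polynomial.C (w i)))) = aeval v := by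
    ext i
    simp
  have := DFunLike.congr_fun h f
  rw [Polynomial.coeff_zero_eq_eval_zero]
  simpa [restrictToLine, Polynomial.aeval_def, aeval_eq_eval] using! this

theorem derivative_restrictToLine (f : MvPolynomial (Fin 3) K) (v w : Fin 3 → K) :
    Polynomial.derivative (restrictToLine f v w) =
      ∑ i, restrictToLine (pderiv i f) v w * Polynomial.C (w i) := by
  have h := derivation_aeval (Polynomial.derivative' (R := K))
    (fun i => Polynomial.C (v i) + Polynomial.X * Polynomial.C (w i)) f
  rw [Polynomial.derivative'_apply] at h
  unfold restrictToLine
  rw [h]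
  refine Finset.sum_congr rfl fun j _ => ?_
  rw [smul_eq_mul, Polynomial.derivative'_apply]
  simp

theorem restrictToLine_coeff_one (f : MvPolynomial (Fin 3) K) (v w : Fin 3 → K) :
    (restrictToLine f v w).coeff 1 = ∑ i, eval v (pderiv i f) * w i := by
  have h := congrArg (fun p : Polynomial K => p.coeff 0) (derivative_restrictToLine f v w)
  simp only [Polynomial.coeff_derivative, Polynomial.finsetSum_coeff, Polynomial.coeff_mul_C,
    restrictToLine_coeff_zero, zero_add, Nat.cast_zero, mul_one] at h
  exact h

theorem aeval_mul_of_isHomogeneous {R B ι : Type*} [CommRing R] [CommRing B] [Algebra R B]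
    [Fintype ι] {f : MvPolynomial ι R} {n : ℕ} (hf : f.IsHomogeneous n) (r : B) (x : ι → B) :
    aeval (fun i => r * x i) f = r ^ n * aeval x f := by
  rw [aeval_def, aeval_def, eval₂_eq', eval₂_eq', Finset.mul_sum]
  refine Finset.sum_congr rfl fun d hd => ?_
  have hdn : ∑ i, d i = n := by
    have := hf (mem_support_iff.mp hd)
    simpa [Finsupp.weight_apply, Finsupp.sum_fintype] using this
  rw [mul_left_comm, ← hdn, ← Finset.prod_pow_eq_pow_sum, ← Finset.prod_mul_distrib]
  simp only [mul_pow]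

theorem restrictToLine_smul {f : MvPolynomial (Fin 3) K} (hf : f.IsHomogeneous 3) (c : K)
    (v w : Fin 3 → K) :
    restrictToLine f (c • v) (c • w) = Polynomial.C (c ^ 3) * restrictToLine f v w := by
  unfold restrictToLine
  rw [map_pow, ← aeval_mul_of_isHomogeneous hf]
  congr 2
  ext1 i
  simp only [Pi.smul_apply, smul_eq_mul, map_mul]
  ring

/-- `v` represents an inflection point of `f = 0`. -/
def IsInflection (f : MvPolynomial (Fin 3) K) (v : Fin 3 → K) : Prop :=
  (∀ w, (restrictToLine f v w).coeff 0 = 0) ∧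
    ∀ w, (restrictToLine f v w).coeff 1 = 0 → (restrictToLine f v w).coeff 2 = 0

/-- The coefficients of degree 0 and 1 of the restriction are the value and the directional
derivative. Tangency and triple contact can thus be phrased through restrictions to lines alone, a
form that visibly respects linear substitution. -/
theorem isInflection_iff (f : MvPolynomial (Fin 3) K) (v : Fin 3 → K) :
    IsInflection f v ↔ eval v f = 0 ∧ ∀ w, ∑ i, eval v (pderiv i f) * w i = 0 →
      Polynomial.X ^ 3 ∣ restrictToLine f v w := by
  unfold IsInflection
  simp only [restrictToLine_coeff_zero, forall_const, restrictToLine_coeff_one]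
  refine and_congr_right fun h0 => forall_congr' fun w => imp_congr_right fun h1 => ?_
  rw [Polynomial.X_pow_dvd_iff]
  constructor
  · intro h2 d hd
    interval_cases d
    · rw [restrictToLine_coeff_zero, h0]
    · rw [restrictToLine_coeff_one, h1]
    · exact h2
  · intro h
    exact h 2 (by norm_num)

theorem isInflection_smul {f : MvPolynomial (Fin 3) K} (hf : f.IsHomogeneous 3) {c : K}
    (hc : c ≠ 0) {v : Fin 3 → K} (h : IsInflection f v) : IsInflection f (c • v) := by
  have key (w : Fin 3 → K) : restrictToLine f (c • v) w =
      Polynomial.C (c ^ 3) * restrictToLine f v (c⁻¹ • w) := by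
    rw [← restrictToLine_smul hf, smul_inv_smul₀ hc]
  refine ⟨fun w => ?_, fun w hw => ?_⟩
  · rw [key, Polynomial.coeff_C_mul, h.1, mul_zero]
  · rw [key, Polynomial.coeff_C_mul] at hw ⊢
    rw [h.2 _ ((mul_eq_zero.mp hw).resolve_left (pow_ne_zero 3 hc)), mul_zero]

theorem mk_mem_inflectionPoints {f : MvPolynomial (Fin 3) K} (hf : f.IsHomogeneous 3)
    {v : Fin 3 → K} (hv : v ≠ 0) :
    Projectivization.mk K v hv ∈ inflectionPoints f ↔ IsInflection f v := by
  obtain ⟨c, hc⟩ := Projectivization.exists_smul_eq_mk_rep K v hv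
  have hc' : (c : K) • v = (Projectivization.mk K v hv).rep := hc
  have : Projectivization.mk K v hv ∈ inflectionPoints f ↔ IsInflection f ((c : K) • v) := by
    rw [isInflection_iff, hc']
    rfl
  rw [this]
  refine ⟨fun h => ?_, isInflection_smul hf c.ne_zero⟩
  simpa using isInflection_smul hf (inv_ne_zero c.ne_zero) h

theorem isInflection_linSubst (g : GL (Fin 3) K) (f : MvPolynomial (Fin 3) K) (v : Fin 3 → K) :
    IsInflection (linSubst g.1 f) v ↔ IsInflection f (g • v) := by
  unfold IsInflection
  simp only [restrictToLine_linSubst]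
  exact and_congr ((MulAction.surjective g).forall (p := fun w =>
    (restrictToLine f (g • v) w).coeff 0 = 0)).symm
    ((MulAction.surjective g).forall (p := fun w =>
    (restrictToLine f (g • v) w).coeff 1 = 0 → (restrictToLine f (g • v) w).coeff 2 = 0)).symm

theorem isHomogeneous_linSubst (g : Matrix (Fin 3) (Fin 3) K) {f : MvPolynomial (Fin 3) K}
    (hf : f.IsHomogeneous 3) : (linSubst g f).IsHomogeneous 3 :=
  hf.aeval _ fun _ => IsHomogeneous.sum _ _ _ fun _ _ => (isHomogeneous_X _ _).C_mul _

theorem inflectionPoints_linSubst (g : GL (Fin 3) K) {f : MvPolynomial (Fin 3) K}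
    (hf : f.IsHomogeneous 3) :
    inflectionPoints (linSubst g.1 f) = (Matrix.ProjGenLinGroup.mk g)⁻¹ • inflectionPoints f := by
  ext P
  rw [Set.mem_inv_smul_set_iff]
  induction P using Projectivization.ind with
  | h v hv =>
    rw [mk_mem_inflectionPoints (isHomogeneous_linSubst _ hf), isInflection_linSubst,
      Projectivization.PGL.mk_smul_mk, mk_mem_inflectionPoints hf]

theorem isSmoothCubic_linSubst (g : GL (Fin 3) K) {f : MvPolynomial (Fin 3) K}
    (hf : IsSmoothCubic f) : IsSmoothCubic (linSubst g.1 f) := by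
  refine ⟨isHomogeneous_linSubst _ hf.1, fun v hv h0 => ?_⟩
  rw [aeval_linSubst] at h0
  let h : GL (Fin 3) (AlgebraicClosure K) :=
    Matrix.GeneralLinearGroup.map (algebraMap K (AlgebraicClosure K)) g
  have e : (fun i => ∑ j, algebraMap K (AlgebraicClosure K) (g.1 i j) * v j) = h • v := rfl
  rw [e] at h0
  obtain ⟨i, hi⟩ := hf.2 (h • v) ((smul_ne_zero_iff_ne h).mpr hv) h0
  by_contra! hcon
  -- By the chain rule the gradient of `f ∘ g` at `v` is the gradient of `f` at `g v` times the
  -- invertible matrix `g`, so the two vanish together.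
  have chain (j : Fin 3) : ∑ i, aeval (h • v) (pderiv i f) * h.1 i j = 0 := by
    rw [← hcon j]
    unfold linSubst
    rw [derivation_aeval, map_sum]
    refine Finset.sum_congr rfl fun k _ => ?_
    have := aeval_linSubst g.1 (pderiv k f) v
    rw [e] at this
    rw [smul_eq_mul, map_mul, ← this]
    congr 1
    simp [Derivation.leibniz, pderiv_X, Pi.single_apply, h]
  have hz : Matrix.vecMul (fun i => aeval (h • v) (pderiv i f)) h.1 = 0 := funext chain
  have : (fun i => aeval (h • v) (pderiv i f)) = 0 := by
    have := congrArg (fun u => Matrix.vecMul u (h⁻¹).1) hz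
    simpa [Matrix.vecMul_vecMul, ← Units.val_mul] using this
  exact hi (congrFun this i)

/-! ### Ternary cubics in coordinates -/

/-- The ternary cubic form with given coefficients. -/
noncomputable def ternaryCubic (a : Fin 10 → K) : MvPolynomial (Fin 3) K :=
  C (a 0) * X 0 ^ 3 + C (a 1) * X 1 ^ 3 + C (a 2) * X 2 ^ 3 + C (a 3) * (X 0 ^ 2 * X 1) +
    C (a 4) * (X 0 ^ 2 * X 2) + C (a 5) * (X 1 ^ 2 * X 0) + C (a 6) * (X 1 ^ 2 * X 2) +
    C (a 7) * (X 2 ^ 2 * X 0) + C (a 8) * (X 2 ^ 2 * X 1) + C (a 9) * (X 0 * X 1 * X 2)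

theorem exists_eq_ternaryCubic {f : MvPolynomial (Fin 3) K} (hf : f.IsHomogeneous 3) :
    ∃ a, f = ternaryCubic a := by
  rw [f.as_sum]
  refine Finset.sum_induction _ (fun p => ∃ a, p = ternaryCubic a) ?_ ?_ ?_
  · rintro _ _ ⟨a, rfl⟩ ⟨b, rfl⟩
    refine ⟨a + b, ?_⟩
    simp only [ternaryCubic, Pi.add_apply, map_add]
    ring
  · exact ⟨0, by simp [ternaryCubic]⟩
  · intro d hd
    have h3 : d 0 + d 1 + d 2 = 3 := by
      have := hf (mem_support_iff.mp hd)
      simpa [Finsupp.weight_apply, Finsupp.sum_fintype, Fin.sum_univ_three] using this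
    generalize coeff d f = c
    have hm : monomial d c = C c * (X 0 ^ d 0 * X 1 ^ d 1 * X 2 ^ d 2) := by
      rw [monomial_eq, Finsupp.prod_fintype _ _ (fun _ => pow_zero _), Fin.prod_univ_three]
    rw [hm]
    have h0 : d 0 ≤ 3 := by omega
    have h1 : d 1 ≤ 3 := by omega
    generalize d 0 = i at *
    generalize d 1 = j at *
    generalize d 2 = k at *
    have h2 : k ≤ 3 := by omega
    interval_cases i <;> interval_cases j <;> interval_cases k
    any_goals omega
    · exact ⟨![0, 0, c, 0, 0, 0, 0, 0, 0, 0], by simp [ternaryCubic]⟩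
    · exact ⟨![0, 0, 0, 0, 0, 0, 0, 0, c, 0], by simp [ternaryCubic, mul_comm]⟩
    · exact ⟨![0, 0, 0, 0, 0, 0, c, 0, 0, 0], by simp [ternaryCubic]⟩
    · exact ⟨![0, c, 0, 0, 0, 0, 0, 0, 0, 0], by simp [ternaryCubic]⟩
    · exact ⟨![0, 0, 0, 0, 0, 0, 0, c, 0, 0], by simp [ternaryCubic, mul_comm]⟩
    · exact ⟨![0, 0, 0, 0, 0, 0, 0, 0, 0, c], by simp [ternaryCubic]⟩
    · exact ⟨![0, 0, 0, 0, 0, c, 0, 0, 0, 0], by simp [ternaryCubic, mul_comm]⟩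
    · exact ⟨![0, 0, 0, 0, c, 0, 0, 0, 0, 0], by simp [ternaryCubic]⟩
    · exact ⟨![0, 0, 0, c, 0, 0, 0, 0, 0, 0], by simp [ternaryCubic]⟩
    · exact ⟨![c, 0, 0, 0, 0, 0, 0, 0, 0, 0], by simp [ternaryCubic]⟩

theorem isHomogeneous_ternaryCubic (a : Fin 10 → K) : (ternaryCubic a).IsHomogeneous 3 := by
  have h2 (i j : Fin 3) : (X i ^ 2 * X j : MvPolynomial (Fin 3) K).IsHomogeneous 3 :=
    (isHomogeneous_X_pow i 2).mul (isHomogeneous_X K j)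
  have h1 : (X 0 * X 1 * X 2 : MvPolynomial (Fin 3) K).IsHomogeneous 3 :=
    ((isHomogeneous_X K 0).mul (isHomogeneous_X K 1)).mul (isHomogeneous_X K 2)
  have h3 (i : Fin 3) := isHomogeneous_X_pow (R := K) i 3
  unfold ternaryCubic
  exact (((((((((h3 0).C_mul _).add ((h3 1).C_mul _)).add ((h3 2).C_mul _)).add
    ((h2 _ _).C_mul _)).add ((h2 _ _).C_mul _)).add ((h2 _ _).C_mul _)).add
    ((h2 _ _).C_mul _)).add ((h2 _ _).C_mul _)).add ((h2 _ _).C_mul _) |>.add (h1.C_mul _)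

/-- The top coefficient stays anonymous because inflection only concerns degrees 0, 1 and 2. -/
theorem restrictToLine_ternaryCubic (a : Fin 10 → K) (v w : Fin 3 → K) :
    ∃ c, restrictToLine (ternaryCubic a) v w =
      Polynomial.C (a 0 * v 0 ^ 3 + a 1 * v 1 ^ 3 + a 2 * v 2 ^ 3 + a 3 * (v 0 ^ 2 * v 1) +
        a 4 * (v 0 ^ 2 * v 2) + a 5 * (v 1 ^ 2 * v 0) + a 6 * (v 1 ^ 2 * v 2) +
        a 7 * (v 2 ^ 2 * v 0) + a 8 * (v 2 ^ 2 * v 1) + a 9 * (v 0 * v 1 * v 2)) +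
      Polynomial.C (3 * a 0 * v 0 ^ 2 * w 0 + 3 * a 1 * v 1 ^ 2 * w 1 + 3 * a 2 * v 2 ^ 2 * w 2 +
        a 3 * (2 * v 0 * w 0 * v 1 + v 0 ^ 2 * w 1) + a 4 * (2 * v 0 * w 0 * v 2 + v 0 ^ 2 * w 2) +
        a 5 * (2 * v 1 * w 1 * v 0 + v 1 ^ 2 * w 0) + a 6 * (2 * v 1 * w 1 * v 2 + v 1 ^ 2 * w 2) +
        a 7 * (2 * v 2 * w 2 * v 0 + v 2 ^ 2 * w 0) + a 8 * (2 * v 2 * w 2 * v 1 + v 2 ^ 2 * w 1) +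
        a 9 * (w 0 * v 1 * v 2 + v 0 * w 1 * v 2 + v 0 * v 1 * w 2)) * Polynomial.X +
      Polynomial.C (3 * a 0 * v 0 * w 0 ^ 2 + 3 * a 1 * v 1 * w 1 ^ 2 + 3 * a 2 * v 2 * w 2 ^ 2 +
        a 3 * (2 * v 0 * w 0 * w 1 + w 0 ^ 2 * v 1) + a 4 * (2 * v 0 * w 0 * w 2 + w 0 ^ 2 * v 2) +
        a 5 * (2 * v 1 * w 1 * w 0 + w 1 ^ 2 * v 0) + a 6 * (2 * v 1 * w 1 * w 2 + w 1 ^ 2 * v 2) +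
        a 7 * (2 * v 2 * w 2 * w 0 + w 2 ^ 2 * v 0) + a 8 * (2 * v 2 * w 2 * w 1 + w 2 ^ 2 * v 1) +
        a 9 * (w 0 * w 1 * v 2 + w 0 * v 1 * w 2 + v 0 * w 1 * w 2)) * Polynomial.X ^ 2 +
      Polynomial.C c * Polynomial.X ^ 3 := by
  refine ⟨a 0 * w 0 ^ 3 + a 1 * w 1 ^ 3 + a 2 * w 2 ^ 3 + a 3 * (w 0 ^ 2 * w 1) +
        a 4 * (w 0 ^ 2 * w 2) + a 5 * (w 1 ^ 2 * w 0) + a 6 * (w 1 ^ 2 * w 2) +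
        a 7 * (w 2 ^ 2 * w 0) + a 8 * (w 2 ^ 2 * w 1) + a 9 * (w 0 * w 1 * w 2), ?_⟩
  simp only [restrictToLine, ternaryCubic, map_add, map_mul, map_pow, aeval_X, aeval_C,
    Polynomial.algebraMap_eq, map_ofNat]
  ring

theorem isInflection_ternaryCubic (a : Fin 10 → K) (v : Fin 3 → K) :
    IsInflection (ternaryCubic a) v ↔
      (a 0 * v 0 ^ 3 + a 1 * v 1 ^ 3 + a 2 * v 2 ^ 3 + a 3 * (v 0 ^ 2 * v 1) +
        a 4 * (v 0 ^ 2 * v 2) + a 5 * (v 1 ^ 2 * v 0) + a 6 * (v 1 ^ 2 * v 2) +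
        a 7 * (v 2 ^ 2 * v 0) + a 8 * (v 2 ^ 2 * v 1) + a 9 * (v 0 * v 1 * v 2)) = 0 ∧
      ∀ w : Fin 3 → K,
       (3 * a 0 * v 0 ^ 2 * w 0 + 3 * a 1 * v 1 ^ 2 * w 1 + 3 * a 2 * v 2 ^ 2 * w 2 +
        a 3 * (2 * v 0 * w 0 * v 1 + v 0 ^ 2 * w 1) + a 4 * (2 * v 0 * w 0 * v 2 + v 0 ^ 2 * w 2) +
        a 5 * (2 * v 1 * w 1 * v 0 + v 1 ^ 2 * w 0) + a 6 * (2 * v 1 * w 1 * v 2 + v 1 ^ 2 * w 2) +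
        a 7 * (2 * v 2 * w 2 * v 0 + v 2 ^ 2 * w 0) + a 8 * (2 * v 2 * w 2 * v 1 + v 2 ^ 2 * w 1) +
        a 9 * (w 0 * v 1 * v 2 + v 0 * w 1 * v 2 + v 0 * v 1 * w 2)) = 0 →
       (3 * a 0 * v 0 * w 0 ^ 2 + 3 * a 1 * v 1 * w 1 ^ 2 + 3 * a 2 * v 2 * w 2 ^ 2 +
        a 3 * (2 * v 0 * w 0 * w 1 + w 0 ^ 2 * v 1) + a 4 * (2 * v 0 * w 0 * w 2 + w 0 ^ 2 * v 2) +
        a 5 * (2 * v 1 * w 1 * w 0 + w 1 ^ 2 * v 0) + a 6 * (2 * v 1 * w 1 * w 2 + w 1 ^ 2 * v 2) +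
        a 7 * (2 * v 2 * w 2 * w 0 + w 2 ^ 2 * v 0) + a 8 * (2 * v 2 * w 2 * w 1 + w 2 ^ 2 * v 1) +
        a 9 * (w 0 * w 1 * v 2 + w 0 * v 1 * w 2 + v 0 * w 1 * w 2)) = 0 := by
  have hc (c0 c1 c2 c3 : K) : (Polynomial.C c0 + Polynomial.C c1 * Polynomial.X +
      Polynomial.C c2 * Polynomial.X ^ 2 + Polynomial.C c3 * Polynomial.X ^ 3).coeff 0 = c0 ∧
      (Polynomial.C c0 + Polynomial.C c1 * Polynomial.X +
      Polynomial.C c2 * Polynomial.X ^ 2 + Polynomial.C c3 * Polynomial.X ^ 3).coeff 1 = c1 ∧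
      (Polynomial.C c0 + Polynomial.C c1 * Polynomial.X +
      Polynomial.C c2 * Polynomial.X ^ 2 + Polynomial.C c3 * Polynomial.X ^ 3).coeff 2 = c2 := by
    simp [Polynomial.coeff_X, Polynomial.coeff_C, Polynomial.coeff_X_pow]
  refine and_congr ?_ (forall_congr' fun w => ?_)
  · refine ⟨fun h => ?_, fun h w => ?_⟩
    · obtain ⟨c, hw⟩ := restrictToLine_ternaryCubic a v 0
      have := h 0
      rwa [hw, (hc _ _ _ _).1] at this
    · obtain ⟨c, hw⟩ := restrictToLine_ternaryCubic a v w
      rwa [hw, (hc _ _ _ _).1]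
  · obtain ⟨c, hw⟩ := restrictToLine_ternaryCubic a v w
    rw [hw, (hc _ _ _ _).2.1, (hc _ _ _ _).2.2]

/-- The gradient of a smooth ternary cubic does not vanish at a point of the curve. -/
theorem IsSmoothCubic.not_singular {a : Fin 10 → K} (h : IsSmoothCubic (ternaryCubic a))
    {x y z : AlgebraicClosure K} (hne : ¬ (x = 0 ∧ y = 0 ∧ z = 0))
    (b : Fin 10 → AlgebraicClosure K)
    (hb : b = fun i => algebraMap K (AlgebraicClosure K) (a i))
    (h0 : b 0 * x ^ 3 + b 1 * y ^ 3 + b 2 * z ^ 3 + b 3 * (x ^ 2 * y) + b 4 * (x ^ 2 * z) +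
      b 5 * (y ^ 2 * x) + b 6 * (y ^ 2 * z) + b 7 * (z ^ 2 * x) + b 8 * (z ^ 2 * y) +
      b 9 * (x * y * z) = 0)
    (hx : 3 * b 0 * x ^ 2 + 2 * b 3 * x * y + 2 * b 4 * x * z + b 5 * y ^ 2 + b 7 * z ^ 2 +
      b 9 * (y * z) = 0)
    (hy : 3 * b 1 * y ^ 2 + b 3 * x ^ 2 + 2 * b 5 * y * x + 2 * b 6 * y * z + b 8 * z ^ 2 +
      b 9 * (x * z) = 0)
    (hz : 3 * b 2 * z ^ 2 + b 4 * x ^ 2 + b 6 * y ^ 2 + 2 * b 7 * z * x + 2 * b 8 * z * y +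
      b 9 * (x * y) = 0) : False := by
  subst hb
  obtain ⟨i, hi⟩ := h.2 ![x, y, z] (fun h => hne (by simpa using h)) (by
    simpa [ternaryCubic] using h0)
  apply hi
  fin_cases i
  · rw [← hx]
    simp [ternaryCubic, Derivation.leibniz, Derivation.leibniz_pow, pderiv_X]
    ring
  · rw [← hy]
    simp [ternaryCubic, Derivation.leibniz, Derivation.leibniz_pow, pderiv_X]
    ring
  · rw [← hz]
    simp [ternaryCubic, Derivation.leibniz, Derivation.leibniz_pow, pderiv_X]
    ring

/-! ### Reduction of a smooth cubic to the Hesse pencil -/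

/-- A finite field is perfect, so separably closed would mean algebraically closed, hence infinite.
Infinitude lets identities of polynomials be checked on values. -/
theorem infinite_of_isSepClosed [IsSepClosed K] : Infinite K := by
  by_contra h
  rw [not_infinite_iff_finite] at h
  have : IsAlgClosed K := inferInstance
  have : Infinite K := inferInstance
  exact not_finite K

theorem eval_ternaryCubic (a : Fin 10 → K) (v : Fin 3 → K) :
    eval v (ternaryCubic a) = a 0 * v 0 ^ 3 + a 1 * v 1 ^ 3 + a 2 * v 2 ^ 3 +
      a 3 * (v 0 ^ 2 * v 1) + a 4 * (v 0 ^ 2 * v 2) + a 5 * (v 1 ^ 2 * v 0) +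
      a 6 * (v 1 ^ 2 * v 2) + a 7 * (v 2 ^ 2 * v 0) + a 8 * (v 2 ^ 2 * v 1) +
      a 9 * (v 0 * v 1 * v 2) := by
  simp [ternaryCubic]

/-- If the line `z = 0` through the two points were tangent at one of them, triple contact there
would make the cubic vanish on that line. The cubic would then be reducible, and singular where the
line meets the residual conic. -/
theorem coeff_ne_zero_of_inflection (h2 : (2 : K) ≠ 0) {a : Fin 10 → K}
    (h : IsSmoothCubic (ternaryCubic a))
    (hP : IsInflection (ternaryCubic a) ![0, 1, 0])
    (hQ : IsInflection (ternaryCubic a) ![1, 0, 0]) :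
    a 0 = 0 ∧ a 1 = 0 ∧ a 3 ≠ 0 ∧ a 5 ≠ 0 := by
  rw [isInflection_ternaryCubic] at hP hQ
  have h1 : a 1 = 0 := by simpa using hP.1
  have h0 : a 0 = 0 := by simpa using hQ.1
  have e35 : a 5 = 0 → a 3 = 0 := fun h5 => by simpa [h5] using hP.2 ![1, 0, 0]
  have e53 : a 3 = 0 → a 5 = 0 := fun h3 => by simpa [h3] using hQ.2 ![0, 1, 0]
  have h3 : a 3 ≠ 0 := by
    intro h3
    have h5 := e53 h3
    let b : Fin 10 → AlgebraicClosure K := fun i => algebraMap K (AlgebraicClosure K) (a i)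
    have b0 : b 0 = 0 := by simp [b, h0]
    have b1 : b 1 = 0 := by simp [b, h1]
    have b3 : b 3 = 0 := by simp [b, h3]
    have b5 : b 5 = 0 := by simp [b, h5]
    have b2 : (2 : AlgebraicClosure K) ≠ 0 := by
      rw [← map_ofNat (algebraMap K (AlgebraicClosure K))]
      exact (map_ne_zero _).mpr h2
    -- A point of `z = 0` on the residual conic, found by the quadratic formula over the algebraic
    -- closure.
    obtain ⟨x, y, hne, hq⟩ : ∃ x y : AlgebraicClosure K, ¬ (x = 0 ∧ y = 0) ∧
        b 4 * x ^ 2 + b 6 * y ^ 2 + b 9 * (x * y) = 0 := by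
      by_cases h4 : b 4 = 0
      · exact ⟨1, 0, by simp, by simp [h4]⟩
      · obtain ⟨s, hs⟩ := IsAlgClosed.exists_pow_nat_eq (b 9 ^ 2 - 4 * b 4 * b 6) two_pos
        refine ⟨(s - b 9) / (2 * b 4), 1, by simp, ?_⟩
        field_simp
        linear_combination hs
    refine h.not_singular (x := x) (y := y) (z := 0) (by simpa using hne) b rfl ?_ ?_ ?_ ?_
    · simp [b0, b1, b3, b5]
    · simp [b0, b3, b5]
    · simp [b1, b3, b5]
    · linear_combination hq
  exact ⟨h0, h1, h3, fun h5 => h3 (e35 h5)⟩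

theorem exists_linSubst_eq_of_inflection [IsSepClosed K] (h2 : (2 : K) ≠ 0) {a : Fin 10 → K}
    (h : IsSmoothCubic (ternaryCubic a))
    (hP : IsInflection (ternaryCubic a) ![0, 1, 0])
    (hQ : IsInflection (ternaryCubic a) ![1, 0, 0]) :
    ∃ (g : GL (Fin 3) K) (α β γ κ : K), α ≠ 0 ∧ β ≠ 0 ∧
      linSubst g.1 (ternaryCubic a) = ternaryCubic ![0, 0, κ, α, 0, β, 0, 0, 0, γ] := by
  have := infinite_of_isSepClosed (K := K)
  obtain ⟨h0, h1, h3, h5⟩ := coeff_ne_zero_of_inflection h2 h hP hQ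
  rw [isInflection_ternaryCubic] at hP hQ
  -- The tangents at the two points are `a₅x + a₆z = 0` and `a₃y + a₄z = 0`. Triple contact along
  -- each determines `a₈` and `a₇`.
  have e1 := hP.2 ![-a 6, 0, a 5] (by simp; ring)
  have e2 := hQ.2 ![0, -a 4, a 3] (by simp; ring)
  obtain ⟨p, h6⟩ : ∃ p, a 6 = p * a 5 := ⟨a 6 / a 5, by field_simp⟩
  obtain ⟨q, h4⟩ : ∃ q, a 4 = q * a 3 := ⟨a 4 / a 3, by field_simp⟩
  have h8 : a 8 = a 9 * p - a 3 * p ^ 2 := by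
    simp [h6] at e1
    refine mul_left_cancel₀ (pow_ne_zero 2 h5) ?_
    linear_combination e1
  have h7 : a 7 = a 9 * q - a 5 * q ^ 2 := by
    simp [h4] at e2
    refine mul_left_cancel₀ (pow_ne_zero 2 h3) ?_
    linear_combination e2
  -- New coordinates `x + pz`, `y + qz`, `z`, in which the two tangents become `x = 0` and `y = 0`.
  let M : Matrix (Fin 3) (Fin 3) K := !![1, 0, -p; 0, 1, -q; 0, 0, 1]
  have hM : M.det ≠ 0 := by simp [M, Matrix.det_fin_three]
  refine ⟨Matrix.GeneralLinearGroup.mkOfDetNeZero M hM, a 3, a 5,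
    a 9 - 2 * a 3 * p - 2 * a 5 * q,
    eval ![-p, -q, 1] (ternaryCubic a), h3, h5, ?_⟩
  refine MvPolynomial.funext fun v => ?_
  rw [eval_linSubst, eval_ternaryCubic, eval_ternaryCubic, eval_ternaryCubic]
  have hv : (Matrix.GeneralLinearGroup.mkOfDetNeZero M hM).1.mulVec v =
      ![v 0 - p * v 2, v 1 - q * v 2, v 2] := by
    ext i
    fin_cases i <;>
      simp [M, Matrix.GeneralLinearGroup.mkOfDetNeZero, Matrix.mulVec, dotProduct,
        Fin.sum_univ_three] <;> ring
  rw [hv]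
  simp [h0, h1, h4, h6, h7, h8]
  ring

theorem mkOfDetNeZero_val (M : Matrix (Fin 3) (Fin 3) K) (hM : M.det ≠ 0) :
    (Matrix.GeneralLinearGroup.mkOfDetNeZero M hM).1 = M := rfl

theorem exists_linSubst_eq_hesse [IsSepClosed K] (h3 : (3 : K) ≠ 0) {ρ : K}
    (hρ : IsPrimitiveRoot ρ 3)
    {α β γ κ : K} (hα : α ≠ 0) (hβ : β ≠ 0)
    (h : IsSmoothCubic (ternaryCubic ![0, 0, κ, α, 0, β, 0, 0, 0, γ])) :
    ∃ (g : GL (Fin 3) K) (r m : K),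
      linSubst g.1 (ternaryCubic ![0, 0, κ, α, 0, β, 0, 0, 0, γ]) =
        ternaryCubic ![r, r, r, 0, 0, 0, 0, 0, 0, r * m] := by
  have := infinite_of_isSepClosed (K := K)
  have hsum : ρ ^ 2 + ρ + 1 = 0 := by
    have := hρ.geom_sum_eq_zero (by norm_num)
    simp only [Finset.sum_range_succ, Finset.sum_range_zero] at this
    linear_combination this
  have hρ1 : ρ ≠ 1 := hρ.ne_one (by norm_num)
  have hρ0 : ρ ≠ 0 := hρ.ne_zero (by norm_num)
  obtain ⟨k, rfl⟩ : ∃ k, γ = -3 * k := ⟨-γ / 3, by field_simp⟩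
  -- Otherwise the cubic is singular at `(k/α, k/β, 1)`.
  have he : α * β * κ - k ^ 3 ≠ 0 := by
    intro he
    let A := algebraMap K (AlgebraicClosure K)
    have Aα : A α ≠ 0 := (map_ne_zero A).mpr hα
    have Aβ : A β ≠ 0 := (map_ne_zero A).mpr hβ
    have Ae : A α * A β * A κ - A k ^ 3 = 0 := by simpa using congrArg A he
    refine h.not_singular (x := A k / A α) (y := A k / A β) (z := 1) (by simp) _ rfl ?_ ?_ ?_ ?_
    · simp
      change A κ + A α * (_) + A β * (_) + -(3 * A k * _) = 0
      field_simp
      linear_combination Ae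
    · simp
      change 2 * A α * _ * _ + A β * _ + -(3 * A k * _) = 0
      field_simp
      ring
    · simp
      change A α * _ + 2 * A β * _ * _ + -(3 * A k * _) = 0
      field_simp
      ring
    · simp
      change 3 * A κ + -(3 * A k * _) = 0
      field_simp
      linear_combination 3 * Ae
  have : NeZero ((3 : ℕ) : K) := ⟨by exact_mod_cast h3⟩
  obtain ⟨t, ht⟩ := IsSepClosed.exists_pow_nat_eq (-1 / (α * β * κ - k ^ 3)) 3
  have ht' : (α * β * κ - k ^ 3) * t ^ 3 = -1 := by rw [ht]; field_simp
  have ht0 : t ≠ 0 := by rintro rfl; simp at ht'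
  -- With `s = kz`, `αx = s + v₀ + v₁` and `βy = s + ρv₀ + ρ²v₁`, the factor `αx + βy - 3s` is `-(s
  -- + ρ²v₀ + ρv₁)`. The product of the three is therefore `-(s³ + v₀³ + v₁³ - 3sv₀v₁)`. The choice
  -- of `t` in `z = tv₂` normalises the coefficient of `v₂³`.
  let M : Matrix (Fin 3) (Fin 3) K :=
    !![1 / α, 1 / α, k * t / α; ρ / β, ρ ^ 2 / β, k * t / β; 0, 0, t]
  have hM : M.det ≠ 0 := by
    have : M.det = ρ * (ρ - 1) * t / (α * β) := by
      simp [M, Matrix.det_fin_three]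
      field_simp
    rw [this]
    have := sub_ne_zero.mpr hρ1
    positivity
  refine ⟨Matrix.GeneralLinearGroup.mkOfDetNeZero M hM, -1 / (α * β), -3 * k * t, ?_⟩
  refine MvPolynomial.funext fun v => ?_
  rw [eval_linSubst, eval_ternaryCubic, eval_ternaryCubic]
  have hv : (Matrix.GeneralLinearGroup.mkOfDetNeZero M hM).1.mulVec v =
      ![(v 0 + v 1 + k * t * v 2) / α, (ρ * v 0 + ρ ^ 2 * v 1 + k * t * v 2) / β, t * v 2] := by
    rw [mkOfDetNeZero_val]
    ext i
    fin_cases i <;> simp [M, Matrix.mulVec, dotProduct, Fin.sum_univ_three] <;> ring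
  rw [hv]
  simp
  field_simp
  linear_combination v 2 ^ 3 * ht' + (v 0 + v 1 + t * v 2 * k) *
    ((v 0 + v 1) * (ρ * (v 0 + v 1 * ρ) + t * v 2 * k) - ((ρ - 1) * (v 0 ^ 2 + v 1 ^ 2) +
      v 0 * v 1 * (1 + ρ ^ 2 - ρ) + (v 0 + v 1) * (t * v 2 * k))) * hsum

end

/-! ### The inflection points of the Fermat cubic -/

section

open Matrix (ProjGenLinGroup)

variable {K : Type*} [Field K]

/-- The nine points `xyz = 0`, `x³ + y³ + z³ = 0`. -/
def hessePoints (K : Type*) [Field K] : Set (Plane K) :=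
  {P | P.rep 0 * P.rep 1 * P.rep 2 = 0 ∧ P.rep 0 ^ 3 + P.rep 1 ^ 3 + P.rep 2 ^ 3 = 0}

theorem mk_mem_hessePoints {v : Fin 3 → K} (hv : v ≠ 0) :
    Projectivization.mk K v hv ∈ hessePoints K ↔
      v 0 * v 1 * v 2 = 0 ∧ v 0 ^ 3 + v 1 ^ 3 + v 2 ^ 3 = 0 := by
  obtain ⟨c, hc⟩ := Projectivization.exists_smul_eq_mk_rep K v hv
  have hc0 : (c : K) ≠ 0 := c.ne_zero
  have h (i : Fin 3) : (Projectivization.mk K v hv).rep i = c * v i := by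
    rw [← hc]; rfl
  simp only [hessePoints, Set.mem_ofPred_eq, h]
  have e1 : (c : K) * v 0 * (c * v 1) * (c * v 2) = c ^ 3 * (v 0 * v 1 * v 2) := by ring
  have e2 : ((c : K) * v 0) ^ 3 + (c * v 1) ^ 3 + (c * v 2) ^ 3 =
    c ^ 3 * (v 0 ^ 3 + v 1 ^ 3 + v 2 ^ 3) := by ring
  rw [e1, e2]
  simp [hc0]

theorem ne_zero_of_cubes {v : Fin 3 → K} (hv : v ≠ 0) (h : v 0 ^ 3 + v 1 ^ 3 + v 2 ^ 3 = 0)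
    (i j : Fin 3) (hi : v i = 0) (hij : j ≠ i) : v j ≠ 0 := by
  intro hj
  apply hv
  ext k
  fin_cases i <;> fin_cases j <;> first | exact absurd rfl hij | skip
  all_goals
    simp at hi hj
    simp [hi, hj] at h
    fin_cases k <;> simp [hi, hj, h]

/-- The points of `hessePoints` are inflection points of all cubics of the Hesse pencil. -/
theorem hessePoints_subset_inflectionPoints (r m : K) :
    hessePoints K ⊆ inflectionPoints (ternaryCubic ![r, r, r, 0, 0, 0, 0, 0, 0, r * m]) := by
  intro P hP
  induction P using Projectivization.ind with
  | h v hv =>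
    rw [mk_mem_hessePoints] at hP
    obtain ⟨hp, hs⟩ := hP
    rw [mk_mem_inflectionPoints (isHomogeneous_ternaryCubic _), isInflection_ternaryCubic]
    refine ⟨?_, fun w hw => ?_⟩
    · simp
      linear_combination r * hs + r * m * hp
    simp at hw ⊢
    -- Say `v₀ = 0`. Multiplying the second-order coefficient by `v₁v₂` and subtracting `w₁v₂ +
    -- w₂v₁` times the tangent equation cancels every term in `m` and leaves a multiple of `v₁³ +
    -- v₂³`. The other two cases are the same.
    rcases mul_eq_zero.mp hp with hp | h2
    · rcases mul_eq_zero.mp hp with h0 | h1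
      · have n1 := ne_zero_of_cubes hv hs 0 1 h0 (by decide)
        have n2 := ne_zero_of_cubes hv hs 0 2 h0 (by decide)
        simp only [h0] at hw hs ⊢
        refine mul_left_cancel₀ (mul_ne_zero n1 n2) ?_
        linear_combination (w 1 * v 2 + w 2 * v 1) * hw - 3 * r * w 1 * w 2 * hs
      · have n1 := ne_zero_of_cubes hv hs 1 0 h1 (by decide)
        have n2 := ne_zero_of_cubes hv hs 1 2 h1 (by decide)
        simp only [h1] at hw hs ⊢
        refine mul_left_cancel₀ (mul_ne_zero n1 n2) ?_
        linear_combination (w 0 * v 2 + w 2 * v 0) * hw - 3 * r * w 0 * w 2 * hs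
    · have n1 := ne_zero_of_cubes hv hs 2 0 h2 (by decide)
      have n2 := ne_zero_of_cubes hv hs 2 1 h2 (by decide)
      simp only [h2] at hw hs ⊢
      refine mul_left_cancel₀ (mul_ne_zero n1 n2) ?_
      linear_combination (w 0 * v 1 + w 1 * v 0) * hw - 3 * r * w 0 * w 1 * hs

theorem inflectionPoints_fermat (h3 : (3 : K) ≠ 0) :
    inflectionPoints (ternaryCubic (K := K) ![1, 1, 1, 0, 0, 0, 0, 0, 0, 0]) = hessePoints K := by
  refine Set.Subset.antisymm ?_ (by simpa using hessePoints_subset_inflectionPoints (1 : K) 0)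
  intro P hP
  induction P using Projectivization.ind with
  | h v hv =>
    rw [mk_mem_inflectionPoints (isHomogeneous_ternaryCubic _), isInflection_ternaryCubic] at hP
    rw [mk_mem_hessePoints]
    have hs : v 0 ^ 3 + v 1 ^ 3 + v 2 ^ 3 = 0 := by simpa using hP.1
    refine ⟨?_, hs⟩
    -- Along this tangent direction the second-order coefficient is `3v₀v₁(v₀³ + v₁³)`, which equals
    -- `-3v₀v₁v₂³` on the curve.
    have := hP.2 ![v 1 ^ 2, -v 0 ^ 2, 0] (by simp; ring)
    simp at this
    by_cases h2 : v 2 = 0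
    · simp [h2]
    · refine mul_left_cancel₀ (mul_ne_zero h3 (pow_ne_zero 2 h2)) ?_
      linear_combination 3 * v 0 * v 1 * hs - this

theorem isSmoothCubic_fermat (h3 : (3 : K) ≠ 0) :
    IsSmoothCubic (ternaryCubic (K := K) ![1, 1, 1, 0, 0, 0, 0, 0, 0, 0]) := by
  refine ⟨isHomogeneous_ternaryCubic _, fun v hv _ => ?_⟩
  by_contra! h
  have h3' : (3 : AlgebraicClosure K) ≠ 0 := by
    rw [← map_ofNat (algebraMap K (AlgebraicClosure K))]
    exact (map_ne_zero _).mpr h3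
  apply hv
  ext i
  have := h i
  fin_cases i <;>
    simpa [ternaryCubic, Derivation.leibniz, Derivation.leibniz_pow, MvPolynomial.pderiv_X, h3']
      using this

/-! ### Coordinates on the nine points, and the Heisenberg matrices -/

/-- The character `a ↦ ρ ^ a` of `ℤ/3`. -/
def chi (ρ : K) (a : Fin 3) : K := ρ ^ (a : ℕ)

@[simp] theorem chi_zero (ρ : K) : chi ρ 0 = 1 := by simp [chi]

@[simp] theorem chi_one (ρ : K) : chi ρ 1 = ρ := by simp [chi]

theorem chi_add {ρ : K} (hρ : IsPrimitiveRoot ρ 3) (a b : Fin 3) :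
    chi ρ (a + b) = chi ρ a * chi ρ b := by
  rw [chi, chi, chi, ← pow_add, Fin.val_add]
  exact (pow_eq_pow_mod _ hρ.pow_eq_one).symm

theorem chi_ne_zero {ρ : K} (hρ : IsPrimitiveRoot ρ 3) (a : Fin 3) : chi ρ a ≠ 0 :=
  pow_ne_zero _ (hρ.ne_zero (by norm_num))

theorem chi_injective {ρ : K} (hρ : IsPrimitiveRoot ρ 3) : Function.Injective (chi ρ) :=
  fun a b h => Fin.ext (hρ.pow_inj a.2 b.2 h)

theorem chi_pow_three {ρ : K} (hρ : IsPrimitiveRoot ρ 3) (a : Fin 3) : chi ρ a ^ 3 = 1 := by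
  rw [chi, pow_right_comm, hρ.pow_eq_one, one_pow]

/-- The vector with entries `0, 1, -ρ ^ p.1`, starting at position `p.2`. -/
def hesseVec (ρ : K) (p : Fin 3 × Fin 3) : Fin 3 → K :=
  fun i => if i = p.2 then 0 else if i = p.2 + 1 then 1 else -chi ρ p.1

theorem hesseVec_zero (ρ : K) (p : Fin 3 × Fin 3) : hesseVec ρ p p.2 = 0 := by simp [hesseVec]

theorem hesseVec_one (ρ : K) (p : Fin 3 × Fin 3) : hesseVec ρ p (p.2 + 1) = 1 := by
  simp [hesseVec]

theorem hesseVec_two (ρ : K) (p : Fin 3 × Fin 3) : hesseVec ρ p (p.2 + 2) = -chi ρ p.1 := by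
  simp [hesseVec]

theorem hesseVec_ne_zero (ρ : K) (p : Fin 3 × Fin 3) : hesseVec ρ p ≠ 0 := fun h => by
  simpa [hesseVec_one] using congrFun h (p.2 + 1)

/-- The nine points of `hessePoints`, labelled by `(ℤ/3)²`. -/
def hessePt (ρ : K) (p : Fin 3 × Fin 3) : Plane K :=
  Projectivization.mk K (hesseVec ρ p) (hesseVec_ne_zero ρ p)

theorem hessePt_injective {ρ : K} (hρ : IsPrimitiveRoot ρ 3) :
    Function.Injective (hessePt ρ) := by
  intro p q h
  obtain ⟨c, hc⟩ := (Projectivization.mk_eq_mk_iff' K _ _ _ _).mp h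
  have h0 := hesseVec_zero ρ p
  have h1 := hesseVec_one ρ p
  have h2 := hesseVec_two ρ p
  rw [← hc, Pi.smul_apply, smul_eq_mul] at h0 h1 h2
  have hc0 : c ≠ 0 := by rintro rfl; simp at h1
  have hn := chi_ne_zero hρ
  have hpq : p.2 = q.2 := by
    by_contra hne
    have := (mul_eq_zero.mp h0).resolve_left hc0
    unfold hesseVec at this
    rw [if_neg hne] at this
    split_ifs at this
    · exact one_ne_zero this
    · exact hn _ (neg_eq_zero.mp this)
  rw [hpq, hesseVec_one] at h1
  rw [hpq, hesseVec_two] at h2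
  have : chi ρ q.1 = chi ρ p.1 := by linear_combination -h2 - chi ρ q.1 * h1
  exact Prod.ext (chi_injective hρ this).symm hpq

theorem range_hessePt {ρ : K} (hρ : IsPrimitiveRoot ρ 3) :
    Set.range (hessePt ρ) = hessePoints K := by
  ext P
  constructor
  · rintro ⟨⟨a, j⟩, rfl⟩
    have h3 := chi_pow_three hρ a
    rw [hessePt, mk_mem_hessePoints]
    fin_cases j <;> simp [hesseVec, Odd.neg_pow (by decide : Odd 3), h3]
  · intro hP
    induction P using Projectivization.ind with
    | h v hv =>
      rw [mk_mem_hessePoints] at hP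
      obtain ⟨hp, hs⟩ := hP
      obtain ⟨j, hj⟩ : ∃ j, v j = 0 := by
        rcases mul_eq_zero.mp hp with hp | h2
        · rcases mul_eq_zero.mp hp with h0 | h1
          exacts [⟨0, h0⟩, ⟨1, h1⟩]
        · exact ⟨2, h2⟩
      have n1 := ne_zero_of_cubes hv hs j (j + 1) hj (by simp)
      have hs' : v (j + 1) ^ 3 + v (j + 2) ^ 3 = 0 := by
        fin_cases j <;> simp at hj ⊢ <;> simp [hj] at hs <;> linear_combination hs
      obtain ⟨k, hk, hk'⟩ := hρ.eq_pow_of_pow_eq_one (ξ := -v (j + 2) / v (j + 1)) (by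
        field_simp
        linear_combination -hs')
      refine ⟨(⟨k, hk⟩, j), ?_⟩
      rw [hessePt, Projectivization.mk_eq_mk_iff']
      refine ⟨(v (j + 1))⁻¹, ?_⟩
      have hall : ∀ i j : Fin 3, i = j ∨ i = j + 1 ∨ i = j + 2 := by decide
      ext i
      rcases hall i j with rfl | rfl | rfl
      · simp [hesseVec, hj]
      · simp [hesseVec, n1]
      · have := hesseVec_two ρ (⟨k, hk⟩, j)
        simp only at this
        rw [this, chi, hk']
        simp
        field_simp

theorem ncard_hessePoints {ρ : K} (hρ : IsPrimitiveRoot ρ 3) : (hessePoints K).ncard = 9 := by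
  rw [← range_hessePt hρ, ← Set.image_univ, Set.ncard_image_of_injective _ (hessePt_injective hρ),
    Set.ncard_univ]
  simp

/-- The Heisenberg matrix sending `v` to `i ↦ ρ ^ (u.1 * i) * v (i - u.2)`. -/
def heisMatrix (ρ : K) (u : Fin 3 × Fin 3) : Matrix (Fin 3) (Fin 3) K :=
  Matrix.of fun i k => if k = i - u.2 then chi ρ (u.1 * i) else 0

theorem heisMatrix_mulVec (ρ : K) (u : Fin 3 × Fin 3) (v : Fin 3 → K) (i : Fin 3) :
    (heisMatrix ρ u).mulVec v i = chi ρ (u.1 * i) * v (i - u.2) := by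
  simp [heisMatrix, Matrix.mulVec, dotProduct]

theorem heisMatrix_mul {ρ : K} (hρ : IsPrimitiveRoot ρ 3) (u w : Fin 3 × Fin 3) :
    heisMatrix ρ u * heisMatrix ρ w = chi ρ (-(w.1 * u.2)) • heisMatrix ρ (u + w) := by
  refine Matrix.ext_of_mulVec_single fun j => ?_
  generalize (Pi.single j 1 : Fin 3 → K) = v
  ext i
  rw [← Matrix.mulVec_mulVec, Matrix.smul_mulVec, Pi.smul_apply, heisMatrix_mulVec,
    heisMatrix_mulVec, heisMatrix_mulVec, smul_eq_mul, ← mul_assoc, ← mul_assoc,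
    ← chi_add hρ, ← chi_add hρ, Prod.fst_add, Prod.snd_add, sub_sub]
  have : ∀ a b c d i : Fin 3, a * i + c * (i - b) = -(c * b) + (a + c) * i := by decide
  rw [this u.1 u.2 w.1 w.2 i]

theorem heisMatrix_zero (ρ : K) : heisMatrix ρ 0 = 1 := by
  ext i j
  simp [heisMatrix, Matrix.one_apply, eq_comm]

theorem chi_mul_chi_neg {ρ : K} (hρ : IsPrimitiveRoot ρ 3) (a : Fin 3) :
    chi ρ a * chi ρ (-a) = 1 := by rw [← chi_add hρ, add_neg_cancel, chi_zero]

/-- The Heisenberg matrices as invertible matrices. -/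
def heisGL {ρ : K} (hρ : IsPrimitiveRoot ρ 3) (u : Fin 3 × Fin 3) : GL (Fin 3) K where
  val := heisMatrix ρ u
  inv := chi ρ (-(u.1 * u.2)) • heisMatrix ρ (-u)
  val_inv := by
    have : ∀ a b : Fin 3, -(-a * b) = a * b := by decide
    rw [Matrix.mul_smul, heisMatrix_mul hρ, add_neg_cancel, heisMatrix_zero, Prod.fst_neg, this,
      smul_smul, mul_comm, chi_mul_chi_neg hρ, one_smul]
  inv_val := by
    have : ∀ a b : Fin 3, -(a * -b) = a * b := by decide
    rw [Matrix.smul_mul, heisMatrix_mul hρ, neg_add_cancel, heisMatrix_zero, Prod.snd_neg, this,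
      smul_smul, mul_comm, chi_mul_chi_neg hρ, one_smul]

theorem heisGL_smul_hesseVec {ρ : K} (hρ : IsPrimitiveRoot ρ 3) (u p : Fin 3 × Fin 3) :
    heisGL hρ u • hesseVec ρ p =
      chi ρ (u.1 * (p.2 + u.2 + 1)) • hesseVec ρ (p + u) := by
  have hall : ∀ i j : Fin 3, i = j ∨ i = j + 1 ∨ i = j + 2 := by decide
  have sub1 : ∀ j u : Fin 3, j + u + 1 - u = j + 1 := by decide
  have sub2 : ∀ j u : Fin 3, j + u + 2 - u = j + 2 := by decide
  ext i
  change (heisMatrix ρ u).mulVec _ i = _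
  rw [heisMatrix_mulVec, Pi.smul_apply, smul_eq_mul]
  rcases hall i (p + u).2 with rfl | rfl | rfl
  · rw [hesseVec_zero, Prod.snd_add, add_sub_cancel_right, hesseVec_zero, mul_zero, mul_zero]
  · rw [hesseVec_one, Prod.snd_add, sub1, hesseVec_one]
  · rw [hesseVec_two, Prod.snd_add, sub2, hesseVec_two, mul_neg, mul_neg, ← chi_add hρ,
      ← chi_add hρ, Prod.fst_add]
    have : ∀ a b c d : Fin 3, a * (b + c + 2) + d = a * (b + c + 1) + (d + a) := by decide
    rw [this]

theorem heisGL_smul_hessePt {ρ : K} (hρ : IsPrimitiveRoot ρ 3) (u p : Fin 3 × Fin 3) :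
    ProjGenLinGroup.mk (heisGL hρ u) • hessePt ρ p = hessePt ρ (p + u) := by
  rw [hessePt, hessePt, Projectivization.PGL.mk_smul_mk, Projectivization.mk_eq_mk_iff']
  exact ⟨_, (heisGL_smul_hesseVec hρ u p).symm⟩

/-- An element of `PGL₃` is determined by its action on the nine points. -/
theorem eq_of_smul_hessePt {ρ : K} (hρ : IsPrimitiveRoot ρ 3) {φ ψ : PGL(3, K)}
    (h : ∀ p, φ • hessePt ρ p = ψ • hessePt ρ p) : φ = ψ := by
  suffices H : ∀ φ : PGL(3, K), (∀ p, φ • hessePt ρ p = hessePt ρ p) → φ = 1 by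
    rw [← inv_mul_eq_one]
    exact H _ fun p => by rw [mul_smul, ← h, inv_smul_smul]
  clear h φ ψ
  intro φ h
  induction φ using ProjGenLinGroup.induction_on with
  | mk g =>
    have hρ1 : ρ - 1 ≠ 0 := sub_ne_zero.mpr (hρ.ne_one (by norm_num))
    have hvec (p : Fin 3 × Fin 3) : ∃ c : K, ∀ i, c * hesseVec ρ p i =
        ∑ k, g.1 i k * hesseVec ρ p k := by
      have := h p
      rw [hessePt, Projectivization.PGL.mk_smul_mk, Projectivization.mk_eq_mk_iff'] at this
      obtain ⟨c, hc⟩ := this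
      exact ⟨c, fun i => congrFun hc i⟩
    -- Two points on each coordinate line suffice. The row where both vectors vanish gives two
    -- independent equations, since `ρ ≠ 1`, for the off-diagonal entries of that row; comparing the
    -- remaining rows equates the diagonal entries.
    obtain ⟨c, hc⟩ := hvec (0, 0)
    obtain ⟨c', hc'⟩ := hvec (1, 0)
    obtain ⟨d, hd⟩ := hvec (0, 1)
    obtain ⟨d', hd'⟩ := hvec (1, 1)
    obtain ⟨e, he⟩ := hvec (0, 2)
    obtain ⟨e', he'⟩ := hvec (1, 2)
    simp [Fin.forall_fin_succ, Fin.sum_univ_three, hesseVec] at hc hc' hd hd' he he'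
    have g02 : g.1 0 2 = 0 := mul_right_cancel₀ hρ1 (by linear_combination hc'.1 - hc.1)
    have g01 : g.1 0 1 = 0 := by linear_combination -hc.1 + g02
    have g10 : g.1 1 0 = 0 := mul_right_cancel₀ hρ1 (by linear_combination hd'.2.1 - hd.2.1)
    have g12 : g.1 1 2 = 0 := by linear_combination -hd.2.1 + g10
    have g21 : g.1 2 1 = 0 := mul_right_cancel₀ hρ1 (by linear_combination he'.2.2 - he.2.2)
    have g20 : g.1 2 0 = 0 := by linear_combination -he.2.2 + g21
    have g11 : g.1 1 1 = g.1 2 2 := by linear_combination -hc.2.1 - hc.2.2 + g12 - g21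
    have g00 : g.1 0 0 = g.1 2 2 := by linear_combination hd.1 + hd.2.2 - g20 + g02
    rw [ProjGenLinGroup.mk_eq_one,
      Matrix.GeneralLinearGroup.mem_center_iff_val_mem_range_scalar]
    refine ⟨g.1 2 2, ?_⟩
    ext i j
    fin_cases i <;> fin_cases j <;> simp [g02, g01, g10, g12, g21, g20, g11, g00]

/-! ### Collinearity of the nine points -/

theorem isCollinear_mk_iff {u v w : Fin 3 → K} (hu : u ≠ 0) (hv : v ≠ 0) (hw : w ≠ 0) :
    Projectivization.IsCollinear {Projectivization.mk K u hu, Projectivization.mk K v hv,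
      Projectivization.mk K w hw} ↔ (Matrix.of ![u, v, w]).det = 0 := by
  have hli : LinearIndependent K ![u, v, w] ↔ (Matrix.of ![u, v, w]).det ≠ 0 := by
    have := Matrix.linearIndependent_rows_iff_isUnit (A := Matrix.of ![u, v, w])
    rw [Matrix.isUnit_iff_isUnit_det, isUnit_iff_ne_zero] at this
    exact this
  constructor
  · rintro ⟨M, -, hM, hs⟩
    by_contra hdet
    have h3 := finrank_span_eq_card (hli.mpr hdet)
    have hle : Submodule.span K (Set.range ![u, v, w]) ≤ M.submodule := by
      rw [Submodule.span_le]
      rintro _ ⟨i, rfl⟩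
      fin_cases i
      · exact (Projectivization.Subspace.mem_submodule_iff M hu).mpr (hs (by simp))
      · exact (Projectivization.Subspace.mem_submodule_iff M hv).mpr (hs (by simp))
      · exact (Projectivization.Subspace.mem_submodule_iff M hw).mpr (hs (by simp))
    have := Submodule.finrank_mono hle
    rw [h3, Fintype.card_fin] at this
    omega
  · intro hdet
    let M := Submodule.span K (Set.range ![u, v, w])
    have hlt : Module.finrank K M ≤ 2 := by
      have h1 := finrank_range_le_card (R := K) ![u, v, w]
      have h2 : ¬ _ := fun h => hli.mp (linearIndependent_iff_card_eq_finrank_span.mpr h) hdet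
      rw [Fintype.card_fin] at h1 h2
      change Module.finrank K M ≤ 3 at h1
      change ¬ 3 = Module.finrank K M at h2
      omega
    refine ⟨M.projectivization, ?_, ?_, ?_⟩
    · rw [Projectivization.Subspace.submodule.apply_symm_apply]
      infer_instance
    · rwa [Projectivization.Subspace.submodule.apply_symm_apply]
    · rintro P (rfl | rfl | rfl)
      · exact Submodule.subset_span ⟨0, rfl⟩
      · exact Submodule.subset_span ⟨1, rfl⟩
      · exact Submodule.subset_span ⟨2, rfl⟩

/-- The second label says which coordinate line contains the point. With one point on each
coordinate line, the determinant vanishes exactly when the three characters have product one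
(Menelaus). With exactly two points on one line, a zero determinant would force these two to
coincide. On a single line, three elements of `ℤ/3` sum to zero exactly when they are all distinct
or all equal. -/
theorem col_hessePt_iff {ρ : K} (hρ : IsPrimitiveRoot ρ 3) (p q r : Fin 3 × Fin 3) :
    Col (hessePt ρ p) (hessePt ρ q) (hessePt ρ r) ↔ p + q + r = 0 := by
  unfold Col
  rw [(hessePt_injective hρ).ne_iff, (hessePt_injective hρ).ne_iff,
    (hessePt_injective hρ).ne_iff, (hessePt_injective hρ).eq_iff, (hessePt_injective hρ).eq_iff,
    hessePt, hessePt, hessePt, isCollinear_mk_iff]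
  obtain ⟨a, i⟩ := p
  obtain ⟨b, j⟩ := q
  obtain ⟨c, k⟩ := r
  have hprod : chi ρ a * chi ρ b * chi ρ c = 1 ↔ a + b + c = 0 := by
    rw [← chi_add hρ, ← chi_add hρ, ← chi_zero ρ, (chi_injective hρ).eq_iff]
  rw [Matrix.det_fin_three]
  fin_cases i <;> fin_cases j <;> fin_cases k <;> simp [hesseVec]
  any_goals
    clear * -
    revert a b c
    decide
  any_goals
    rw [← hprod]
    constructor <;> intro h <;> first | linear_combination h | linear_combination -h
  all_goals
    intro hne h
    refine hne ((chi_injective hρ).eq_iff.mp ?_)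
    first
    | linear_combination h
    | linear_combination -h
    | exact mul_left_cancel₀ (chi_ne_zero hρ a) (by linear_combination h)
    | exact mul_left_cancel₀ (chi_ne_zero hρ b) (by linear_combination h)
    | exact mul_left_cancel₀ (chi_ne_zero hρ c) (by linear_combination h)
    | exact mul_left_cancel₀ (chi_ne_zero hρ a) (by linear_combination -h)
    | exact mul_left_cancel₀ (chi_ne_zero hρ b) (by linear_combination -h)
    | exact mul_left_cancel₀ (chi_ne_zero hρ c) (by linear_combination -h)

/-! ### The group attached to the nine points -/

theorem mem_translationGroup {I : Set (Plane K)} {φ : PGL(3, K)} :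
    φ ∈ translationGroup I ↔ ∃ h : φ ∈ MulAction.stabilizer PGL(3, K) I,
      ∀ e : E I, (⟨φ, h⟩ : MulAction.stabilizer PGL(3, K) I) • e = e := by
  simp only [translationGroup, Subgroup.mem_map, MonoidHom.mem_ker, Subgroup.subtype_apply]
  constructor
  · rintro ⟨ψ, hψ, rfl⟩
    exact ⟨ψ.2, fun e => DFunLike.congr_fun hψ e⟩
  · rintro ⟨h, he⟩
    exact ⟨⟨φ, h⟩, Equiv.ext he, rfl⟩

theorem hessePt_mem {ρ : K} (hρ : IsPrimitiveRoot ρ 3) (p : Fin 3 × Fin 3) :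
    hessePt ρ p ∈ hessePoints K := range_hessePt hρ ▸ ⟨p, rfl⟩

theorem exists_eq_hessePt {ρ : K} (hρ : IsPrimitiveRoot ρ 3) {P : Plane K}
    (hP : P ∈ hessePoints K) : ∃ p, P = hessePt ρ p := by
  rw [← range_hessePt hρ] at hP
  obtain ⟨p, rfl⟩ := hP
  exact ⟨p, rfl⟩

/-- The third point collinear with those labelled `p` and `s` is labelled `-(p + s)`, so a common
`T` exists exactly when `p + s = r + q`. Hence `E(I)` is the group of differences of labels. -/
theorem pairRel_hessePoints_iff {ρ : K} (hρ : IsPrimitiveRoot ρ 3) (p q r s : Fin 3 × Fin 3) :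
    PairRel (hessePoints K) (⟨hessePt ρ p, hessePt_mem hρ p⟩, ⟨hessePt ρ q, hessePt_mem hρ q⟩)
      (⟨hessePt ρ r, hessePt_mem hρ r⟩, ⟨hessePt ρ s, hessePt_mem hρ s⟩) ↔ p - q = r - s := by
  rw [sub_eq_sub_iff_add_eq_add]
  constructor
  · rintro ⟨⟨T, hT⟩, h1, h2⟩
    obtain ⟨t, rfl⟩ := exists_eq_hessePt hρ hT
    simp only [col_hessePt_iff hρ] at h1 h2
    exact add_right_cancel (h1.trans h2.symm)
  · intro h
    refine ⟨⟨hessePt ρ (-(p + s)), hessePt_mem hρ _⟩, ?_, ?_⟩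
    · exact (col_hessePt_iff hρ _ _ _).mpr (add_neg_cancel _)
    · exact (col_hessePt_iff hρ _ _ _).mpr (by rw [h]; exact add_neg_cancel _)

theorem smul_hessePoints_of_translation {ρ : K} (hρ : IsPrimitiveRoot ρ 3)
    (u : Fin 3 × Fin 3) : ProjGenLinGroup.mk (heisGL hρ u) • hessePoints K = hessePoints K := by
  refine Set.Subset.antisymm ?_ ?_
  · rintro _ ⟨P, hP, rfl⟩
    obtain ⟨p, rfl⟩ := exists_eq_hessePt hρ hP
    simp only [heisGL_smul_hessePt]
    exact hessePt_mem hρ _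
  · intro P hP
    obtain ⟨p, rfl⟩ := exists_eq_hessePt hρ hP
    exact ⟨hessePt ρ (p - u), hessePt_mem hρ _, by
      simp only [heisGL_smul_hessePt, sub_add_cancel]⟩

theorem mem_translationGroup_hessePoints {ρ : K} (hρ : IsPrimitiveRoot ρ 3) (φ : PGL(3, K)) :
    φ ∈ translationGroup (hessePoints K) ↔ ∃ u, φ = ProjGenLinGroup.mk (heisGL hρ u) := by
  rw [mem_translationGroup]
  constructor
  · rintro ⟨hφ, he⟩
    have hmem (p : Fin 3 × Fin 3) : φ • hessePt ρ p ∈ hessePoints K := by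
      have : φ • hessePoints K = hessePoints K := hφ
      rw [← this]
      exact Set.smul_mem_smul_set (hessePt_mem hρ p)
    choose f hf using fun p => exists_eq_hessePt hρ (hmem p)
    let label : Plane K → Fin 3 × Fin 3 := Function.invFun (hessePt ρ)
    have hl (p : Fin 3 × Fin 3) : label (hessePt ρ p) = p :=
      Function.leftInverse_invFun (hessePt_injective hρ) p
    -- Since `φ` fixes every class, it preserves differences of labels. It therefore acts on labels
    -- as translation by the image `f 0` of the origin.
    let diff : E (hessePoints K) → Fin 3 × Fin 3 :=
      Quot.lift (fun a => label a.1 - label a.2) (by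
        rintro ⟨⟨P, hP⟩, ⟨Q, hQ⟩⟩ ⟨⟨R, hR⟩, ⟨S, hS⟩⟩ h
        obtain ⟨p, rfl⟩ := exists_eq_hessePt hρ hP
        obtain ⟨q, rfl⟩ := exists_eq_hessePt hρ hQ
        obtain ⟨r, rfl⟩ := exists_eq_hessePt hρ hR
        obtain ⟨s, rfl⟩ := exists_eq_hessePt hρ hS
        simp only [hl]
        exact (pairRel_hessePoints_iff hρ _ _ _ _).mp h)
    refine ⟨f 0, eq_of_smul_hessePt hρ fun p => ?_⟩
    rw [heisGL_smul_hessePt, hf]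
    have := congrArg diff (he (Quot.mk _ (⟨hessePt ρ p, hessePt_mem hρ p⟩,
      ⟨hessePt ρ 0, hessePt_mem hρ 0⟩)))
    change label (φ • hessePt ρ p) - label (φ • hessePt ρ 0) =
      label (hessePt ρ p) - label (hessePt ρ 0) at this
    rw [hf, hf, hl, hl, hl, hl, sub_zero, sub_eq_iff_eq_add] at this
    rw [this]
  · rintro ⟨u, rfl⟩
    refine ⟨smul_hessePoints_of_translation hρ u, ?_⟩
    rintro ⟨⟨⟨P, hP⟩, ⟨Q, hQ⟩⟩⟩
    obtain ⟨p, rfl⟩ := exists_eq_hessePt hρ hP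
    obtain ⟨q, rfl⟩ := exists_eq_hessePt hρ hQ
    refine Quot.sound ?_
    have := (pairRel_hessePoints_iff hρ (p + u) (q + u) p q).mpr (by abel)
    convert this using 2
    · exact Subtype.ext (heisGL_smul_hessePt hρ u p)
    · exact Subtype.ext (heisGL_smul_hessePt hρ u q)

/-! ### Heisenberg subgroups -/

theorem three_ne_zero_of_isPrimitiveRoot {ρ : K} (hρ : IsPrimitiveRoot ρ 3) : (3 : K) ≠ 0 := by
  have : NeZero ((3 : ℕ) : K) := hρ.neZero'
  exact_mod_cast this.out

theorem mk_heisGL_add {ρ : K} (hρ : IsPrimitiveRoot ρ 3) (u w : Fin 3 × Fin 3) :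
    ProjGenLinGroup.mk (heisGL hρ (u + w)) =
      ProjGenLinGroup.mk (heisGL hρ u) * ProjGenLinGroup.mk (heisGL hρ w) :=
  eq_of_smul_hessePt hρ fun p => by
    rw [mul_smul, heisGL_smul_hessePt, heisGL_smul_hessePt, heisGL_smul_hessePt, add_comm u,
      add_assoc]

theorem translationGroup_hessePoints {ρ : K} (hρ : IsPrimitiveRoot ρ 3) :
    translationGroup (hessePoints K) =
      (Subgroup.closure {heisGL hρ (1, 0), heisGL hρ (0, 1)}).map ProjGenLinGroup.mk := by
  rw [MonoidHom.map_closure]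
  refine le_antisymm ?_ ?_
  · intro φ hφ
    obtain ⟨u, rfl⟩ := (mem_translationGroup_hessePoints hρ φ).mp hφ
    set Γ := Subgroup.closure
      (ProjGenLinGroup.mk '' {heisGL hρ (1, 0), heisGL hρ (0, 1)}) with hΓ
    have hone : ProjGenLinGroup.mk (heisGL hρ 0) = 1 :=
      eq_of_smul_hessePt hρ fun p => by rw [heisGL_smul_hessePt, add_zero, one_smul]
    have hmul (w : Fin 3 × Fin 3) (hw : ProjGenLinGroup.mk (heisGL hρ w) ∈ Γ) (n : ℕ) :
        ProjGenLinGroup.mk (heisGL hρ (n • w)) ∈ Γ := by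
      induction n with
      | zero => rw [zero_smul, hone]; exact Γ.one_mem
      | succ n ih => rw [succ_nsmul, mk_heisGL_add]; exact Γ.mul_mem ih hw
    have hu : ∀ u : Fin 3 × Fin 3,
      u = (u.1 : ℕ) • ((1, 0) : Fin 3 × Fin 3) + (u.2 : ℕ) • ((0, 1) : Fin 3 × Fin 3) := by decide
    rw [hu u, mk_heisGL_add]
    exact Γ.mul_mem (hmul _ (Subgroup.subset_closure ⟨_, Or.inl rfl, rfl⟩) _)
      (hmul _ (Subgroup.subset_closure ⟨_, Or.inr rfl, rfl⟩) _)
  · rw [Subgroup.closure_le]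
    rintro _ ⟨_, rfl | rfl, rfl⟩
    exacts [(mem_translationGroup_hessePoints hρ _).mpr ⟨_, rfl⟩,
      (mem_translationGroup_hessePoints hρ _).mpr ⟨_, rfl⟩]

theorem card_translationGroup_hessePoints {ρ : K} (hρ : IsPrimitiveRoot ρ 3) :
    Nat.card (translationGroup (hessePoints K)) = 9 := by
  have hinj : Function.Injective fun u => ProjGenLinGroup.mk (heisGL hρ u) := by
    intro u w h
    have := congrArg (fun φ : PGL(3, K) => φ • hessePt ρ 0) h
    simp only [heisGL_smul_hessePt, zero_add] at this
    exact hessePt_injective hρ this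
  have : (translationGroup (hessePoints K) : Set PGL(3, K)) =
      Set.range fun u => ProjGenLinGroup.mk (heisGL hρ u) := by
    ext φ
    rw [SetLike.mem_coe, mem_translationGroup_hessePoints hρ]
    simp only [Set.mem_range, eq_comm]
  rw [← SetLike.coe_sort_coe, this, Nat.card_range_of_injective hinj]
  simp

/-- The exponent is the determinant form on `(ℤ/3)²`, the commutator pairing of the Heisenberg
group. -/
theorem heisMatrix_commute {ρ : K} (hρ : IsPrimitiveRoot ρ 3) (u w : Fin 3 × Fin 3) :
    heisMatrix ρ u * heisMatrix ρ w =
      chi ρ (u.1 * w.2 - w.1 * u.2) • (heisMatrix ρ w * heisMatrix ρ u) := by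
  rw [heisMatrix_mul hρ, heisMatrix_mul hρ, smul_smul, ← chi_add hρ, add_comm w u]
  have : ∀ a b c d : Fin 3, a * d - c * b + -(a * d) = -(c * b) := by decide
  rw [this]

theorem heisGL_pow_three {ρ : K} (hρ : IsPrimitiveRoot ρ 3) (u : Fin 3 × Fin 3) :
    heisGL hρ u ^ 3 = 1 := by
  refine Units.ext ?_
  change heisMatrix ρ u ^ 3 = 1
  rw [pow_succ, pow_two, heisMatrix_mul hρ, Matrix.smul_mul, heisMatrix_mul hρ, smul_smul,
    ← chi_add hρ]
  have h1 : ∀ u : Fin 3 × Fin 3, u + u + u = 0 := by decide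
  have h2 : ∀ u : Fin 3 × Fin 3, -(u.1 * u.2) + -(u.1 * (u + u).2) = 0 := by decide
  rw [h1, h2, chi_zero, one_smul, heisMatrix_zero]

/-- Two matrices of order three that commute up to the factor `ρ` are simultaneously conjugate to
the standard Heisenberg generators. -/
theorem exists_conj_heisGL {ρ : K} (hρ : IsPrimitiveRoot ρ 3) {x y : GL (Fin 3) K}
    (hx : x ^ 3 = 1) (hy : y ^ 3 = 1)
    (hxy : (x * y : Matrix (Fin 3) (Fin 3) K) = ρ • (y * x : Matrix (Fin 3) (Fin 3) K)) :
    ∃ g : GL (Fin 3) K, x = g * heisGL hρ (1, 0) * g⁻¹ ∧ y = g * heisGL hρ (0, 1) * g⁻¹ := by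
  have h3 := three_ne_zero_of_isPrimitiveRoot hρ
  have hxy' (v : Fin 3 → K) : x • y • v = ρ • (y • x • v) := by
    have := congrArg (fun M : Matrix (Fin 3) (Fin 3) K => M.mulVec v) hxy
    simpa only [Matrix.smul_mulVec, ← Matrix.mulVec_mulVec] using! this
  have hx3 (v : Fin 3 → K) : x • x • x • v = v := by
    rw [← mul_smul, ← mul_smul, mul_assoc, ← pow_three, hx, one_smul]
  have hy3 (v : Fin 3 → K) : y • y • y • v = v := by
    rw [← mul_smul, ← mul_smul, mul_assoc, ← pow_three, hy, one_smul]
  have hρ3 := hρ.pow_eq_one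
  have hsum : ρ ^ 2 + ρ + 1 = 0 := by
    have := hρ.geom_sum_eq_zero (by norm_num)
    simp only [Finset.sum_range_succ, Finset.sum_range_zero] at this
    linear_combination this
  -- The sums below are three times the projections of `u` to the eigenspaces of `x` for `1`, `ρ`
  -- and `ρ²`. They add up to `3u`, so one is nonzero, and applying `y` multiplies the eigenvalue by
  -- `ρ` until it becomes `1`.
  obtain ⟨v, hv0, hv⟩ : ∃ v : Fin 3 → K, v ≠ 0 ∧ x • v = v := by
    obtain ⟨u, hu⟩ := exists_ne (0 : Fin 3 → K)
    obtain ⟨u₁, h1⟩ : ∃ u₁, x • u = u₁ := ⟨_, rfl⟩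
    obtain ⟨u₂, h2⟩ : ∃ u₂, x • u₁ = u₂ := ⟨_, rfl⟩
    have h0 : x • u₂ = u := by rw [← h2, ← h1, hx3]
    by_cases e0 : u + u₁ + u₂ = 0
    · by_cases e1 : u + ρ ^ 2 • u₁ + ρ • u₂ = 0
      · refine ⟨y • (u + ρ • u₁ + ρ ^ 2 • u₂), ?_, ?_⟩
        · rw [Ne, smul_eq_zero_iff_eq]
          intro e2
          have : (3 : K) • u = 0 := by
            linear_combination (norm := module) e0 + e1 + e2 - hsum • (u₁ + u₂)
          exact hu ((smul_eq_zero.mp this).resolve_left h3)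
        · rw [hxy', smul_comm ρ y]
          congr 1
          simp only [smul_add, smul_comm x (_ : K), h0, h1, h2]
          linear_combination (norm := module) hρ3 • u
      · refine ⟨y • y • (u + ρ ^ 2 • u₁ + ρ • u₂), ?_, ?_⟩
        · rwa [Ne, smul_eq_zero_iff_eq, smul_eq_zero_iff_eq]
        · rw [hxy', hxy']
          simp only [smul_comm ρ y]
          congr 2
          simp only [smul_add, smul_comm x (_ : K), h0, h1, h2]
          linear_combination (norm := module) hρ3 • u + (ρ * hρ3) • u₂
    · exact ⟨_, e0, by simp only [smul_add, h0, h1, h2]; abel⟩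
  -- Eigenvectors of `x` for the distinct eigenvalues `1, ρ, ρ²`, permuted cyclically by `y`. They
  -- are the columns of the conjugating matrix.
  let w : Fin 3 → Fin 3 → K := ![v, y • v, y • y • v]
  have hxw (j : Fin 3) : x • w j = chi ρ j • w j := by
    fin_cases j
    · simp [w, hv]
    · simp [w, hxy', hv]
    · change x • y • y • v = ρ ^ 2 • y • y • v
      rw [hxy', hxy', hv, smul_comm y ρ, smul_smul, pow_two]
  have hyw (j : Fin 3) : y • w j = w (j + 1) := by
    fin_cases j <;> simp [w, hy3]
  have hw0 (j : Fin 3) : w j ≠ 0 := by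
    have hy0 (v : Fin 3 → K) : y • v = 0 ↔ v = 0 := smul_eq_zero_iff_eq y
    fin_cases j
    · exact hv0
    · exact fun h => hv0 ((hy0 _).mp h)
    · exact fun h => hv0 ((hy0 _).mp ((hy0 _).mp h))
  have hli : LinearIndependent K w :=
    Module.End.eigenvectors_linearIndependent' (Matrix.mulVecLin x.1) (chi ρ)
      (chi_injective hρ) w fun j => ⟨Module.End.mem_eigenspace_iff.mpr (hxw j), hw0 j⟩
  let M : Matrix (Fin 3) (Fin 3) K := Matrix.of fun i j => w j i
  have hM : IsUnit M := Matrix.linearIndependent_cols_iff_isUnit.mp hli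
  obtain ⟨g, hg⟩ := hM
  have hgi (i j : Fin 3) : g.1 i j = w j i := by rw [hg]; rfl
  refine ⟨g, ?_, ?_⟩
  · rw [eq_mul_inv_iff_mul_eq]
    refine Matrix.GeneralLinearGroup.ext fun i j => ?_
    have h := congrFun (hxw j) i
    have h' : (x.1 * g.1) i j = chi ρ j * w j i := by
      refine Eq.trans ?_ h
      rw [Matrix.mul_apply]
      simp only [hgi]
      rfl
    have e : (g.1 * heisMatrix ρ (1, 0)) i j = chi ρ j * w j i := by
      rw [Matrix.mul_apply, Finset.sum_eq_single j]
      · simp [heisMatrix, hgi, mul_comm]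
      · intro k _ hk
        simp [heisMatrix, hk.symm]
      · simp
    exact h'.trans e.symm
  · rw [eq_mul_inv_iff_mul_eq]
    refine Matrix.GeneralLinearGroup.ext fun i j => ?_
    have h := congrFun (hyw j) i
    have h' : (y.1 * g.1) i j = w (j + 1) i := by
      rw [← h, Matrix.mul_apply]
      simp only [hgi]
      rfl
    have e : (g.1 * heisMatrix ρ (0, 1)) i j = w (j + 1) i := by
      rw [Matrix.mul_apply, Finset.sum_eq_single (j + 1)]
      · simp [heisMatrix, hgi]
      · intro k _ hk
        have : j ≠ k - 1 := fun h => hk (by rw [h, sub_add_cancel])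
        simp [heisMatrix, this]
      · simp
    exact h'.trans e.symm

/-! ### Equivariance -/

theorem conj_mem_translationGroup {I : Set (Plane K)} {ψ : PGL(3, K)}
    (hψ : ψ ∈ translationGroup I) (φ : PGL(3, K)) :
    φ * ψ * φ⁻¹ ∈ translationGroup (φ • I) := by
  obtain ⟨hI, he⟩ := mem_translationGroup.mp hψ
  have hI' : ψ • I = I := hI
  have hstab : (φ * ψ * φ⁻¹) • φ • I = φ • I := by
    rw [mul_smul, mul_smul, inv_smul_smul, hI']
  let f : I → (φ • I : Set (Plane K)) := fun P => ⟨φ • P.1, Set.smul_mem_smul_set P.2⟩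
  let F : E I → E (φ • I) := Quot.map (fun a => (f a.1, f a.2)) (by
    rintro a b ⟨T, h1, h2⟩
    exact ⟨f T, h1.smul φ, h2.smul φ⟩)
  refine mem_translationGroup.mpr ⟨hstab, ?_⟩
  rintro ⟨⟨⟨_, P, hP, rfl⟩, ⟨_, Q, hQ, rfl⟩⟩⟩
  have h := congrArg F (he (Quot.mk _ (⟨P, hP⟩, ⟨Q, hQ⟩)))
  refine Eq.trans ?_ h
  refine congrArg (Quot.mk _) (Prod.ext (Subtype.ext ?_) (Subtype.ext ?_))
  · change (φ * ψ * φ⁻¹) • φ • P = φ • ψ • P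
    rw [mul_smul, mul_smul, inv_smul_smul]
  · change (φ * ψ * φ⁻¹) • φ • Q = φ • ψ • Q
    rw [mul_smul, mul_smul, inv_smul_smul]

theorem translationGroup_smul (φ : PGL(3, K)) (I : Set (Plane K)) :
    translationGroup (φ • I) = (translationGroup I).map (MulAut.conj φ).toMonoidHom := by
  refine le_antisymm ?_ ?_
  · intro ψ hψ
    have := conj_mem_translationGroup hψ φ⁻¹
    rw [inv_smul_smul] at this
    exact ⟨_, this, by simp [mul_assoc]⟩
  · rintro _ ⟨ψ, hψ, rfl⟩
    exact conj_mem_translationGroup hψ φ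

theorem smul_mem_inflectionSets (φ : PGL(3, K)) {I : Set (Plane K)} (hI : I ∈ inflectionSets K) :
    φ • I ∈ inflectionSets K := by
  obtain ⟨hc, f, hf, rfl⟩ := hI
  refine ⟨?_, ?_⟩
  · rw [← hc]
    exact Set.ncard_image_of_injective _ (MulAction.injective φ)
  · induction φ using ProjGenLinGroup.induction_on with
    | mk g =>
      refine ⟨linSubst (g⁻¹).1 f, isSmoothCubic_linSubst _ hf, ?_⟩
      rw [inflectionPoints_linSubst _ hf.1, map_inv, inv_inv]

theorem hessePoints_mem_inflectionSets {ρ : K} (hρ : IsPrimitiveRoot ρ 3) :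
    hessePoints K ∈ inflectionSets K :=
  have h3 := three_ne_zero_of_isPrimitiveRoot hρ
  ⟨ncard_hessePoints hρ, _, isSmoothCubic_fermat h3, (inflectionPoints_fermat h3).symm⟩

/-- Every inflection set is projectively equivalent to the inflection set of the Fermat cubic. -/
theorem exists_eq_smul_hessePoints [IsSepClosed K] (h2 : (2 : K) ≠ 0) {ρ : K}
    (hρ : IsPrimitiveRoot ρ 3) {I : Set (Plane K)} (hI : I ∈ inflectionSets K) :
    ∃ φ : PGL(3, K), I = φ • hessePoints K := by
  have h3 := three_ne_zero_of_isPrimitiveRoot hρ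
  obtain ⟨hc, f, hf, rfl⟩ := hI
  obtain ⟨P, hP, Q, hQ, hPQ⟩ := (Set.one_lt_ncard_iff_nontrivial_and_finite.mp
    (by rw [hc]; norm_num : 1 < (inflectionPoints f).ncard)).1
  have n1 : (![0, 1, 0] : Fin 3 → K) ≠ 0 := fun h => by simpa using congrFun h 1
  have n0 : (![1, 0, 0] : Fin 3 → K) ≠ 0 := fun h => by simpa using congrFun h 0
  have n01 : Projectivization.mk K _ n1 ≠ Projectivization.mk K _ n0 := by
    rw [Ne, Projectivization.mk_eq_mk_iff']
    rintro ⟨c, hc⟩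
    simpa using congrFun hc 1
  -- Double transitivity on points puts the two chosen inflection points in standard position.
  obtain ⟨s, hsP, hsQ⟩ := (MulAction.is_two_pretransitive_iff
    (G := Matrix.SpecialLinearGroup (Fin 3) K)).mp inferInstance n01 hPQ
  let g : GL (Fin 3) K := Matrix.SpecialLinearGroup.toGL s
  have hgP : ProjGenLinGroup.mk g • Projectivization.mk K _ n1 = P := hsP
  have hgQ : ProjGenLinGroup.mk g • Projectivization.mk K _ n0 = Q := hsQ
  have hf1 := isSmoothCubic_linSubst g hf
  obtain ⟨a, ha⟩ := exists_eq_ternaryCubic hf1.1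
  have hiP : IsInflection (linSubst g.1 f) ![0, 1, 0] := by
    rw [← mk_mem_inflectionPoints hf1.1 n1, inflectionPoints_linSubst g hf.1,
      Set.mem_inv_smul_set_iff, hgP]
    exact hP
  have hiQ : IsInflection (linSubst g.1 f) ![1, 0, 0] := by
    rw [← mk_mem_inflectionPoints hf1.1 n0, inflectionPoints_linSubst g hf.1,
      Set.mem_inv_smul_set_iff, hgQ]
    exact hQ
  have hI1 := inflectionPoints_linSubst g hf.1
  rw [ha] at hiP hiQ hf1 hI1
  obtain ⟨g', α, β, γ, κ, hα, hβ, hg'⟩ := exists_linSubst_eq_of_inflection h2 hf1 hiP hiQ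
  have hf2 := isSmoothCubic_linSubst g' hf1
  have hI2 := inflectionPoints_linSubst g' hf1.1
  rw [hg'] at hf2 hI2
  obtain ⟨g'', r, m, hg''⟩ := exists_linSubst_eq_hesse h3 hρ hα hβ hf2
  have hI3 := inflectionPoints_linSubst g'' hf2.1
  rw [hg'', hI2, hI1, smul_smul, smul_smul] at hI3
  have hsub := hessePoints_subset_inflectionPoints r m
  rw [hI3] at hsub
  have hfin : (inflectionPoints f).Finite := Set.finite_of_ncard_pos (by rw [hc]; norm_num)
  -- Counting replaces a determination of all inflection points of a general Hesse cubic.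
  have heq := Set.eq_of_subset_of_ncard_le hsub (by
    rw [ncard_hessePoints hρ, ← hc]
    exact (Set.ncard_image_of_injective _ (MulAction.injective _)).le) (hfin.image _)
  exact ⟨_, eq_inv_smul_iff.mpr heq.symm⟩

theorem map_conj_closure {G : Type*} [Group G] (g x y : G) :
    (Subgroup.closure {x, y}).map (MulAut.conj g).toMonoidHom =
      Subgroup.closure {g * x * g⁻¹, g * y * g⁻¹} := by
  rw [MonoidHom.map_closure, Set.image_pair]
  rfl

/-- The subgroup of `PGL₃` generated by a pair of Heisenberg generators is the group attached to
a translate of the nine points. -/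
theorem exists_map_closure_eq {ρ : K} (hρ : IsPrimitiveRoot ρ 3) {x y : GL (Fin 3) K}
    (hx : x ^ 3 = 1) (hy : y ^ 3 = 1)
    (hxy : (x * y : Matrix (Fin 3) (Fin 3) K) = ρ • (y * x : Matrix (Fin 3) (Fin 3) K)) :
    ∃ φ : PGL(3, K), (Subgroup.closure {x, y}).map ProjGenLinGroup.mk =
        translationGroup (φ • hessePoints K) ∧
      ProjGenLinGroup.mk x = φ * ProjGenLinGroup.mk (heisGL hρ (1, 0)) * φ⁻¹ ∧
      ProjGenLinGroup.mk y = φ * ProjGenLinGroup.mk (heisGL hρ (0, 1)) * φ⁻¹ := by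
  obtain ⟨g, rfl, rfl⟩ := exists_conj_heisGL hρ hx hy hxy
  refine ⟨ProjGenLinGroup.mk g, ?_, by simp, by simp⟩
  rw [translationGroup_smul, translationGroup_hessePoints hρ, MonoidHom.map_closure,
    MonoidHom.map_closure, Set.image_pair, Set.image_pair, map_conj_closure]
  simp

/-- All Heisenberg pairs are conjugate to the standard one, so these subgroups form one conjugacy
class. Order nine is then automatic. -/
theorem mem_heisenbergSubgroups_iff {ρ : K} (hρ : IsPrimitiveRoot ρ 3) (S : Subgroup PGL(3, K)) :
    S ∈ heisenbergSubgroups ρ ↔ ∃ φ : PGL(3, K), S = translationGroup (φ • hessePoints K) := by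
  constructor
  · rintro ⟨-, x, y, hx, hy, hxy, rfl⟩
    obtain ⟨φ, h, -, -⟩ := exists_map_closure_eq hρ hx hy hxy
    exact ⟨φ, h⟩
  · rintro ⟨φ, rfl⟩
    induction φ using ProjGenLinGroup.induction_on with
    | mk g =>
      refine ⟨?_, g * heisGL hρ (1, 0) * g⁻¹, g * heisGL hρ (0, 1) * g⁻¹, ?_, ?_, ?_, ?_⟩
      · rw [translationGroup_smul, ← card_translationGroup_hessePoints hρ]
        exact Nat.card_congr (Subgroup.equivMapOfInjective _ _
          (MulAut.conj _).injective).symm.toEquiv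
      · rw [conj_pow, heisGL_pow_three hρ, mul_one, mul_inv_cancel]
      · rw [conj_pow, heisGL_pow_three hρ, mul_one, mul_inv_cancel]
      · have h : heisMatrix ρ (1, 0) * heisMatrix ρ (0, 1) =
            ρ • (heisMatrix ρ (0, 1) * heisMatrix ρ (1, 0)) := by
          simpa using heisMatrix_commute hρ (1, 0) (0, 1)
        have e (a b : GL (Fin 3) K) : ((g * a * g⁻¹ : GL (Fin 3) K) * (g * b * g⁻¹ : GL (Fin 3) K) :
            Matrix (Fin 3) (Fin 3) K) = g.1 * (a.1 * b.1) * (g⁻¹).1 := by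
          simp only [← Units.val_mul]
          group
        rw [e, e, ← Matrix.smul_mul, ← Matrix.mul_smul]
        exact congrArg (fun M => g.1 * M * (g⁻¹).1) h
      · rw [translationGroup_smul, translationGroup_hessePoints hρ, MonoidHom.map_closure,
          Set.image_pair, map_conj_closure, MonoidHom.map_closure, Set.image_pair]
        simp

/-! ### Invariant lines -/

theorem exists_image_line (φ : PGL(3, K)) (W : Submodule K (Fin 3 → K)) :
    ∃ W' : Submodule K (Fin 3 → K), Module.finrank K W' = Module.finrank K W ∧
      ∀ Q, φ • Q ∈ W'.projectivization ↔ Q ∈ W.projectivization := by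
  induction φ using ProjGenLinGroup.induction_on with
  | mk g =>
    let e : (Fin 3 → K) ≃ₗ[K] (Fin 3 → K) := DistribMulAction.toLinearEquiv K (Fin 3 → K) g
    refine ⟨W.map e.toLinearMap, LinearEquiv.finrank_map_eq e W, fun Q => ?_⟩
    induction Q using Projectivization.ind with
    | h v hv =>
      rw [Projectivization.PGL.mk_smul_mk, Submodule.mk_mem_projectivization_iff,
        Submodule.mk_mem_projectivization_iff]
      exact ⟨fun ⟨w, hw, h⟩ => e.injective (a₁ := w) (a₂ := v) h ▸ hw, fun h => ⟨v, h, rfl⟩⟩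

theorem smul_mem_onInvariantLine (φ x : PGL(3, K)) {P : Plane K} (hP : P ∈ onInvariantLine x) :
    φ • P ∈ onInvariantLine (φ * x * φ⁻¹) := by
  obtain ⟨W, hW, hx, hPW⟩ := hP
  obtain ⟨W', hW', hmem⟩ := exists_image_line φ W
  refine ⟨W', hW'.trans hW, fun Q hQ => ?_, (hmem P).mpr hPW⟩
  rw [mul_smul, mul_smul, hmem]
  refine hx _ ((hmem _).mp ?_)
  rwa [smul_inv_smul]

theorem onInvariantLine_conj (φ x : PGL(3, K)) :
    onInvariantLine (φ * x * φ⁻¹) = φ • onInvariantLine x := by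
  ext P
  rw [Set.mem_smul_set_iff_inv_smul_mem]
  constructor
  · intro h
    have := smul_mem_onInvariantLine φ⁻¹ _ h
    convert this using 2
    group
  · intro h
    have := smul_mem_onInvariantLine φ _ h
    rwa [smul_inv_smul] at this

/-- An invariant line through `v` also contains `g v` and `g² v`. This turns membership into a cubic
equation in `v`. -/
theorem det_eq_zero_of_mem_onInvariantLine {g : GL (Fin 3) K} {v : Fin 3 → K} (hv : v ≠ 0)
    (h : Projectivization.mk K v hv ∈ onInvariantLine (ProjGenLinGroup.mk g)) :
    (Matrix.of ![v, g • v, g • g • v]).det = 0 := by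
  obtain ⟨W, hW, hg, hP⟩ := h
  have n1 : g • v ≠ 0 := (smul_ne_zero_iff_ne g).mpr hv
  have n2 : g • g • v ≠ 0 := (smul_ne_zero_iff_ne g).mpr n1
  rw [← isCollinear_mk_iff hv n1 n2]
  refine ⟨W.projectivization, ?_, ?_, ?_⟩
  · rw [Projectivization.Subspace.submodule.apply_symm_apply]
    infer_instance
  · rw [Projectivization.Subspace.submodule.apply_symm_apply]
    exact hW.le
  · rintro _ (rfl | rfl | rfl)
    exacts [hP, hg _ hP, hg _ (hg _ hP)]

theorem finrank_submodule_eq_two {M : Projectivization.Subspace K (Fin 3 → K)}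
    (h2 : Module.finrank K M.submodule ≤ 2) {P Q : Plane K} (hPQ : P ≠ Q) (hP : P ∈ M)
    (hQ : Q ∈ M) : M.submodule = Submodule.span K {P.rep, Q.rep} ∧
      Module.finrank K M.submodule = 2 := by
  have hli := Projectivization.linearIndependent_pair_iff_ne.mpr hPQ
  have hfr := finrank_span_eq_card hli
  rw [Fintype.card_fin, Matrix.range_cons, Matrix.range_cons, Matrix.range_empty,
    Set.union_empty] at hfr
  change Module.finrank K (Submodule.span K {P.rep, Q.rep}) = 2 at hfr
  have hle : Submodule.span K {P.rep, Q.rep} ≤ M.submodule := by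
    rw [Submodule.span_le]
    rintro _ (rfl | rfl)
    · rw [SetLike.mem_coe, Projectivization.Subspace.mem_submodule_iff _ P.rep_nonzero,
        Projectivization.mk_rep]
      exact hP
    · rw [SetLike.mem_coe, Projectivization.Subspace.mem_submodule_iff _ Q.rep_nonzero,
        Projectivization.mk_rep]
      exact hQ
  have := Submodule.eq_of_le_of_finrank_le hle (by rw [hfr]; exact h2)
  exact ⟨this.symm, this ▸ hfr⟩

/-- For `u ≠ 0` the points labelled `p`, `p + u`, `p + 2u` are collinear because their labels sum to
zero, and translation by `u` permutes them, so it preserves their line. -/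
theorem hessePt_mem_onInvariantLine {ρ : K} (hρ : IsPrimitiveRoot ρ 3) (u p : Fin 3 × Fin 3) :
    hessePt ρ p ∈ onInvariantLine (ProjGenLinGroup.mk (heisGL hρ u)) := by
  have main (u : Fin 3 × Fin 3) (hu : u ≠ 0) :
      hessePt ρ p ∈ onInvariantLine (ProjGenLinGroup.mk (heisGL hρ u)) := by
    have h3 : ∀ p u : Fin 3 × Fin 3, p + (p + u) + (p + u + u) = 0 := by decide
    have hn1 : p ≠ p + u := by simpa using hu
    have hn2 : p + u ≠ p + u + u := by simpa using hu
    have hcol := (col_hessePt_iff hρ _ _ _).mpr (h3 p u)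
    rcases hcol with ⟨n1, n2, -, M, -, hM, hs⟩ | ⟨h, -⟩
    · have m1 : hessePt ρ p ∈ M := hs (by simp)
      have m2 : hessePt ρ (p + u) ∈ M := hs (by simp)
      have m3 : hessePt ρ (p + u + u) ∈ M := hs (by simp)
      obtain ⟨e1, f1⟩ := finrank_submodule_eq_two hM n1 m1 m2
      obtain ⟨W', hW', hmem⟩ := exists_image_line (ProjGenLinGroup.mk (heisGL hρ u)) M.submodule
      have hMM : M.submodule.projectivization = M :=
        Projectivization.Subspace.submodule.symm_apply_apply M
      rw [hMM] at hmem
      have hWM : W' = M.submodule := by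
        have hW2 : Module.finrank K (W'.projectivization).submodule ≤ 2 := by
          rw [Projectivization.Subspace.submodule.apply_symm_apply, hW']
          exact hM
        have i2 := (hmem _).mpr m1
        have i3 := (hmem _).mpr m2
        rw [heisGL_smul_hessePt] at i2 i3
        have := (finrank_submodule_eq_two hW2 n2 i2 i3).1
        rw [Projectivization.Subspace.submodule.apply_symm_apply] at this
        rw [this, (finrank_submodule_eq_two hM n2 m2 m3).1]
      refine ⟨M.submodule, f1, fun Q hQ => ?_, by rwa [hMM]⟩
      rw [hWM, hMM] at hmem
      rw [hMM] at hQ ⊢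
      exact (hmem Q).mpr hQ
    · exact absurd (hessePt_injective hρ h) hn1
  -- For `u = 0` the element is the identity, and any line through the point will do.
  by_cases hu : u = 0
  · obtain ⟨W, hW, -, hP⟩ := main (1, 0) (by decide)
    refine ⟨W, hW, fun Q hQ => ?_, hP⟩
    have : ProjGenLinGroup.mk (heisGL hρ u) = 1 :=
      eq_of_smul_hessePt hρ fun p => by rw [heisGL_smul_hessePt, hu, add_zero, one_smul]
    rwa [this, one_smul]
  · exact main u hu

theorem hessePoints_subset_onInvariantLine {ρ : K} (hρ : IsPrimitiveRoot ρ 3) {x : PGL(3, K)}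
    (hx : x ∈ translationGroup (hessePoints K)) : hessePoints K ⊆ onInvariantLine x := by
  obtain ⟨u, rfl⟩ := (mem_translationGroup_hessePoints hρ x).mp hx
  intro P hP
  obtain ⟨p, rfl⟩ := exists_eq_hessePt hρ hP
  exact hessePt_mem_onInvariantLine hρ u p

/-- For the diagonal generator the determinant of `v, gv, g²v` is `v₀v₁v₂` times a nonzero
Vandermonde determinant. For the cyclic one it is the circulant `v₀³ + v₁³ + v₂³ - 3v₀v₁v₂`.
Together these are the equations of the nine points. -/
theorem onInvariantLine_inter {ρ : K} (hρ : IsPrimitiveRoot ρ 3) :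
    onInvariantLine (ProjGenLinGroup.mk (heisGL hρ (1, 0))) ∩
      onInvariantLine (ProjGenLinGroup.mk (heisGL hρ (0, 1))) = hessePoints K := by
  refine Set.Subset.antisymm ?_ ?_
  · rintro P ⟨h1, h2⟩
    induction P using Projectivization.ind with
    | h v hv =>
      have d1 := det_eq_zero_of_mem_onInvariantLine hv h1
      have d2 := det_eq_zero_of_mem_onInvariantLine hv h2
      have ev (u : Fin 3 × Fin 3) (w : Fin 3 → K) (i : Fin 3) :
        (heisGL hρ u • w) i = chi ρ (u.1 * i) * w (i - u.2) := heisMatrix_mulVec ρ u w i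
      have hs1 : (0 : Fin 3) - 1 = 2 := by decide
      have hs2 : (2 : Fin 3) - 1 = 1 := by decide
      have c2 : chi ρ 2 = ρ ^ 2 := rfl
      rw [Matrix.det_fin_three] at d1 d2
      simp [ev, c2, hs1, hs2] at d1 d2
      rw [mk_mem_hessePoints]
      have hρ1 : ρ - 1 ≠ 0 := sub_ne_zero.mpr (hρ.ne_one (by norm_num))
      have hρ0 := hρ.ne_zero (by norm_num)
      have hρ2 : ρ + 1 ≠ 0 := by
        intro h
        apply hρ.pow_ne_one_of_pos_of_lt (l := 2) (by norm_num) (by norm_num)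
        linear_combination (ρ - 1) * h
      have hv : v 0 * v 1 * v 2 = 0 := by
        refine mul_left_cancel₀ (mul_ne_zero (mul_ne_zero hρ0 (pow_ne_zero 3 hρ1)) hρ2) ?_
        linear_combination d1
      refine ⟨hv, ?_⟩
      linear_combination d2 + 3 * hv
  · exact Set.subset_inter
      (hessePoints_subset_onInvariantLine hρ
        ((mem_translationGroup_hessePoints hρ _).mpr ⟨_, rfl⟩))
      (hessePoints_subset_onInvariantLine hρ
        ((mem_translationGroup_hessePoints hρ _).mpr ⟨_, rfl⟩))

/-- The points of an inflection set are the points lying on an invariant line of every element of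
the attached group. -/
theorem smul_hessePoints_eq {ρ : K} (hρ : IsPrimitiveRoot ρ 3) (φ : PGL(3, K)) :
    φ • hessePoints K = ⋂ x ∈ translationGroup (φ • hessePoints K), onInvariantLine x := by
  refine Set.Subset.antisymm ?_ ?_
  · rw [translationGroup_smul]
    refine Set.subset_iInter₂ fun x hx => ?_
    obtain ⟨s, hs, rfl⟩ := hx
    change _ ⊆ onInvariantLine (φ * s * φ⁻¹)
    rw [onInvariantLine_conj, Set.smul_set_subset_smul_set_iff]
    exact hessePoints_subset_onInvariantLine hρ hs
  · rw [translationGroup_smul]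
    intro P hP
    rw [Set.mem_iInter₂] at hP
    rw [← onInvariantLine_inter hρ, Set.smul_set_inter, ← onInvariantLine_conj,
      ← onInvariantLine_conj]
    exact ⟨hP _ ⟨_, (mem_translationGroup_hessePoints hρ _).mpr ⟨_, rfl⟩, rfl⟩,
      hP _ ⟨_, (mem_translationGroup_hessePoints hρ _).mpr ⟨_, rfl⟩, rfl⟩⟩

theorem eq_of_translationGroup_eq {ρ : K} (hρ : IsPrimitiveRoot ρ 3) {φ ψ : PGL(3, K)}
    (h : translationGroup (φ • hessePoints K) = translationGroup (ψ • hessePoints K)) :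
    φ • hessePoints K = ψ • hessePoints K := by
  rw [smul_hessePoints_eq hρ φ, h, ← smul_hessePoints_eq hρ ψ]

/-- Moving the set conjugates its group, and the group determines the set. Fixing one is therefore
the same as fixing the other. -/
theorem stabilizer_eq_normalizer {ρ : K} (hρ : IsPrimitiveRoot ρ 3) (φ : PGL(3, K)) :
    MulAction.stabilizer PGL(3, K) (φ • hessePoints K) =
      Subgroup.normalizer (translationGroup (φ • hessePoints K) : Set PGL(3, K)) := by
  ext ψ
  rw [Subgroup.mem_normalizer_iff_map_conj_eq, MulAction.mem_stabilizer_iff]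
  refine Iff.trans ?_ (Eq.congr_left (translationGroup_smul ψ _))
  constructor
  · intro h
    rw [h]
  · intro h
    rw [smul_smul] at h ⊢
    exact eq_of_translationGroup_eq hρ h

/-- Generators of the group attached to the nine points determine the nine points. -/
theorem onInvariantLine_inter_of_closure {ρ : K} (hρ : IsPrimitiveRoot ρ 3) {x y : PGL(3, K)}
    (h : Subgroup.closure {x, y} = translationGroup (hessePoints K)) :
    onInvariantLine x ∩ onInvariantLine y = hessePoints K := by
  have hxS : x ∈ translationGroup (hessePoints K) := h ▸ Subgroup.subset_closure (by simp)
  have hyS : y ∈ translationGroup (hessePoints K) := h ▸ Subgroup.subset_closure (by simp)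
  obtain ⟨u, rfl⟩ := (mem_translationGroup_hessePoints hρ x).mp hxS
  obtain ⟨w, rfl⟩ := (mem_translationGroup_hessePoints hρ y).mp hyS
  have hcomm := heisMatrix_commute hρ u w
  set c := u.1 * w.2 - w.1 * u.2 with hc
  -- If `c = 0`, the lifts of the two generators commute. A matrix commuting with both lifts
  -- commutes with every Heisenberg matrix, since passing to `PGL₃` loses only central scalars.
  -- Using this twice makes the standard generators commute, which is false.
  have hc0 : c ≠ 0 := by
    intro h0
    rw [h0, chi_zero, one_smul] at hcomm
    have hxy : heisGL hρ u * heisGL hρ w = heisGL hρ w * heisGL hρ u := Units.ext hcomm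
    have hcent (z : GL (Fin 3) K) (hu : heisGL hρ u * z = z * heisGL hρ u)
        (hw : heisGL hρ w * z = z * heisGL hρ w) (t : Fin 3 × Fin 3) :
        heisGL hρ t * z = z * heisGL hρ t := by
      have hle : translationGroup (hessePoints K) ≤
          (Subgroup.centralizer {z}).map ProjGenLinGroup.mk := by
        rw [← h, Subgroup.closure_le]
        rintro _ (rfl | rfl)
        · exact ⟨_, Subgroup.mem_centralizer_singleton_iff.mpr hu, rfl⟩
        · exact ⟨_, Subgroup.mem_centralizer_singleton_iff.mpr hw, rfl⟩
      obtain ⟨d, hd, hdt⟩ := hle ((mem_translationGroup_hessePoints hρ _).mpr ⟨t, rfl⟩)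
      obtain ⟨s, hs, hst⟩ := ProjGenLinGroup.mk_eq_mk_iff'.mp hdt
      have hd' := Subgroup.mem_centralizer_singleton_iff.mp hd
      rw [← hst, mul_assoc, ← Subgroup.mem_center_iff.mp hs z, ← mul_assoc, hd', mul_assoc]
    have hDS := hcent _ (hcent _ rfl hxy.symm (1, 0)).symm (hcent _ hxy rfl (1, 0)).symm (0, 1)
    have h1 := heisMatrix_commute hρ (1, 0) (0, 1)
    have h2 : heisMatrix ρ (0, 1) * heisMatrix ρ (1, 0) =
      heisMatrix ρ (1, 0) * heisMatrix ρ (0, 1) := congrArg Units.val hDS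
    rw [← h2, heisMatrix_mul hρ] at h1
    have h3 := congrFun (congrFun h1 1) 0
    simp [heisMatrix] at h3
    have hne := mul_ne_zero (chi_ne_zero hρ (-1)) (hρ.ne_zero (by norm_num))
    exact hρ.ne_one (by norm_num) (mul_right_cancel₀ hne (by rw [← h3, one_mul]))
  -- The pair satisfies the Heisenberg relations for another primitive cube root of unity. The
  -- results for the standard pair apply to that root because `hessePoints` does not depend on the
  -- choice.
  have hρ' : IsPrimitiveRoot (chi ρ c) 3 :=
    hρ.pow_of_coprime _ ((by decide : ∀ c : Fin 3, c ≠ 0 → (c : ℕ).Coprime 3) c hc0)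
  obtain ⟨φ, hφ, hφu, hφw⟩ := exists_map_closure_eq hρ' (heisGL_pow_three hρ u)
    (heisGL_pow_three hρ w) hcomm
  rw [MonoidHom.map_closure, Set.image_pair, h] at hφ
  rw [hφu, hφw, onInvariantLine_conj, onInvariantLine_conj, ← Set.smul_set_inter,
    onInvariantLine_inter hρ']
  have := eq_of_translationGroup_eq hρ (φ := 1) (ψ := φ) (by rwa [one_smul])
  rw [← this, one_smul]

theorem eq_onInvariantLine_inter {ρ : K} (hρ : IsPrimitiveRoot ρ 3) (φ : PGL(3, K))
    {x y : PGL(3, K)}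
    (h : Subgroup.closure {x, y} = translationGroup (φ • hessePoints K)) :
    φ • hessePoints K = onInvariantLine x ∩ onInvariantLine y := by
  have h' : Subgroup.closure {φ⁻¹ * x * φ⁻¹⁻¹, φ⁻¹ * y * φ⁻¹⁻¹} =
      translationGroup (hessePoints K) := by
    rw [← map_conj_closure, h, ← translationGroup_smul, inv_smul_smul]
  rw [← onInvariantLine_inter_of_closure hρ h', onInvariantLine_conj, onInvariantLine_conj,
    ← Set.smul_set_inter, smul_inv_smul]

/-! ### Galois actions -/

/-- Every `K`-algebra automorphism of `M₃(K)` is inner. -/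
theorem exists_eq_conj (τ : Matrix (Fin 3) (Fin 3) K ≃ₐ[K] Matrix (Fin 3) (Fin 3) K) :
    ∃ h : GL (Fin 3) K, ∀ M, τ M = h.1 * M * (h⁻¹).1 := by
  let L : Matrix (Fin 3) (Fin 3) K ≃ₐ[K] Module.End K (Fin 3 → K) := Matrix.toLinAlgEquiv'
  obtain ⟨T, hT⟩ := AlgEquiv.eq_linearEquivConjAlgEquiv ((L.symm.trans τ).trans L)
  let h : GL (Fin 3) K :=
    { val := LinearMap.toMatrix' T.toLinearMap
      inv := LinearMap.toMatrix' T.symm.toLinearMap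
      val_inv := by rw [← LinearMap.toMatrix'_comp, LinearEquiv.comp_symm, LinearMap.toMatrix'_id]
      inv_val := by rw [← LinearMap.toMatrix'_comp, LinearEquiv.symm_comp, LinearMap.toMatrix'_id] }
  refine ⟨h, fun M => ?_⟩
  have := congrArg LinearMap.toMatrix' (DFunLike.congr_fun hT (Matrix.toLin' M))
  change LinearMap.toMatrix' (Matrix.toLin' (τ (LinearMap.toMatrix' (Matrix.toLin' M)))) = _ at this
  rw [LinearMap.toMatrix'_toLin', LinearMap.toMatrix'_toLin', LinearEquiv.conjAlgEquiv_apply,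
    LinearMap.toMatrix'_comp, LinearMap.toMatrix'_comp, LinearMap.toMatrix'_toLin'] at this
  rw [this, mul_assoc]
  rfl

variable {F : Type*} [Field F] [Algebra F K]

theorem pglMap_mk (τ : Matrix (Fin 3) (Fin 3) K ≃+* Matrix (Fin 3) (Fin 3) K) (g : GL (Fin 3) K) :
    pglMap τ (ProjGenLinGroup.mk g) =
      ProjGenLinGroup.mk (Units.mapEquiv τ.toMulEquiv g) := rfl

/-- An automorphism of `M₃(K)` that is semilinear over `σ` is the coordinatewise action of `σ`
followed by a conjugation. -/
theorem exists_eq_conj_mapMatrix (σ : Gal(K/F))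
    (τ : Matrix (Fin 3) (Fin 3) K ≃+* Matrix (Fin 3) (Fin 3) K)
    (hτ : ∀ (c : K) M, τ (c • M) = σ c • τ M) :
    ∃ h : GL (Fin 3) K, ∀ M, τ M = h.1 * (σ : K ≃+* K).mapMatrix M * (h⁻¹).1 := by
  let e : Matrix (Fin 3) (Fin 3) K ≃+* Matrix (Fin 3) (Fin 3) K :=
    ((σ : K ≃+* K).mapMatrix (m := Fin 3)).symm.trans τ
  have he (c : K) (M : Matrix (Fin 3) (Fin 3) K) : e (c • M) = c • e M := by
    change τ (((σ : K ≃+* K).mapMatrix (m := Fin 3)).symm (c • M)) = _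
    have : ((σ : K ≃+* K).mapMatrix (m := Fin 3)).symm (c • M) =
        σ.symm c • ((σ : K ≃+* K).mapMatrix (m := Fin 3)).symm M := by
      ext i j
      exact map_mul σ.symm c (M i j)
    rw [this, hτ, AlgEquiv.apply_symm_apply]
    rfl
  let e' : Matrix (Fin 3) (Fin 3) K ≃ₐ[K] Matrix (Fin 3) (Fin 3) K :=
    AlgEquiv.ofRingEquiv (f := e) fun c => by
      rw [Algebra.algebraMap_eq_smul_one, he, map_one]
  obtain ⟨h, hh⟩ := exists_eq_conj e'
  refine ⟨h, fun M => ?_⟩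
  rw [← hh]
  change _ = τ (((σ : K ≃+* K).mapMatrix (m := Fin 3)).symm ((σ : K ≃+* K).mapMatrix M))
  rw [RingEquiv.symm_apply_apply]

/-- Semilinearity is the only property of the twisted action needed for the Galois statements. -/
theorem twist_smul {A : Type*} [Ring A] [Algebra F A]
    (θ : K ⊗[F] A ≃ₐ[K] Matrix (Fin 3) (Fin 3) K) (σ : Gal(K/F)) (c : K)
    (M : Matrix (Fin 3) (Fin 3) K) : twist θ σ (c • M) = σ c • twist θ σ M := by
  change θ (Algebra.TensorProduct.congr σ AlgEquiv.refl (θ.symm (c • M))) =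
    σ c • θ (Algebra.TensorProduct.congr σ AlgEquiv.refl (θ.symm M))
  rw [map_smul, ← map_smul θ]
  congr 1
  generalize θ.symm M = t
  induction t using TensorProduct.induction_on with
  | zero => simp
  | tmul k a => simp [TensorProduct.smul_tmul']
  | add s t hs ht => rw [smul_add, map_add, map_add, smul_add, hs, ht]

theorem planeMap_mk (σ : Gal(K/F)) {v : Fin 3 → K} (hv : v ≠ 0)
    (hv' : (fun i => σ (v i)) ≠ 0) :
    planeMap σ (Projectivization.mk K v hv) = Projectivization.mk K (fun i => σ (v i)) hv' := rfl

theorem comp_ne_zero (σ : Gal(K/F)) {v : Fin 3 → K} (hv : v ≠ 0) : (fun i => σ (v i)) ≠ 0 :=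
  fun h => hv (funext fun i => σ.injective ((congrFun h i).trans (map_zero σ).symm))

theorem planeMap_smul (σ : Gal(K/F)) (φ : PGL(3, K)) (P : Plane K) :
    planeMap σ (φ • P) = pglMap (σ : K ≃+* K).mapMatrix φ • planeMap σ P := by
  induction φ using ProjGenLinGroup.induction_on with
  | mk g =>
    induction P using Projectivization.ind with
    | h v hv =>
      have hgv := (smul_ne_zero_iff_ne g).mpr hv
      rw [Projectivization.PGL.mk_smul_mk, planeMap_mk σ _ (comp_ne_zero σ hgv),
        planeMap_mk σ hv (comp_ne_zero σ hv), pglMap_mk, Projectivization.PGL.mk_smul_mk,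
        Projectivization.mk_eq_mk_iff']
      refine ⟨1, ?_⟩
      rw [one_smul]
      ext i
      exact (RingHom.map_mulVec (σ : K →+* K) g.1 v i).symm

theorem planeMap_image_smul (σ : Gal(K/F)) (φ : PGL(3, K)) (I : Set (Plane K)) :
    planeMap σ '' (φ • I) = pglMap (σ : K ≃+* K).mapMatrix φ • planeMap σ '' I := by
  rw [← Set.image_smul, ← Set.image_smul, Set.image_image, Set.image_image]
  exact Set.image_congr fun P _ => planeMap_smul σ φ P

theorem planeMap_mem_hessePoints (σ : Gal(K/F)) {P : Plane K} (hP : P ∈ hessePoints K) :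
    planeMap σ P ∈ hessePoints K := by
  induction P using Projectivization.ind with
  | h v hv =>
    rw [mk_mem_hessePoints] at hP
    rw [planeMap_mk σ hv (comp_ne_zero σ hv), mk_mem_hessePoints]
    simpa using And.intro (congrArg σ hP.1) (congrArg σ hP.2)

theorem planeMap_symm (σ : Gal(K/F)) (P : Plane K) : planeMap σ (planeMap σ⁻¹ P) = P := by
  induction P using Projectivization.ind with
  | h v hv =>
    rw [planeMap_mk σ⁻¹ hv (comp_ne_zero _ hv), planeMap_mk σ _ (comp_ne_zero _ (comp_ne_zero _ hv)),
      Projectivization.mk_eq_mk_iff']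
    exact ⟨1, by rw [one_smul]; exact funext fun i => (σ.apply_symm_apply (v i)).symm⟩

theorem planeMap_image_hessePoints (σ : Gal(K/F)) :
    planeMap σ '' hessePoints K = hessePoints K := by
  refine Set.Subset.antisymm ?_ fun P hP => ⟨_, planeMap_mem_hessePoints σ⁻¹ hP, planeMap_symm σ P⟩
  rintro _ ⟨P, hP, rfl⟩
  exact planeMap_mem_hessePoints σ hP

/-- Applying `σ` to a Heisenberg matrix for `ρ` gives the one for `σ ρ`. Both families describe the
same group, since the nine points are defined without `ρ`. -/
theorem map_pglMap_translationGroup_hessePoints {ρ : K} (hρ : IsPrimitiveRoot ρ 3) (σ : Gal(K/F)) :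
    (translationGroup (hessePoints K)).map (pglMap (σ : K ≃+* K).mapMatrix) =
      translationGroup (hessePoints K) := by
  have hle (σ : Gal(K/F)) : (translationGroup (hessePoints K)).map
      (pglMap (σ : K ≃+* K).mapMatrix) ≤ translationGroup (hessePoints K) := by
    have hσ : IsPrimitiveRoot (σ ρ) 3 := hρ.map_of_injective σ.injective
    rintro _ ⟨φ, hφ, rfl⟩
    obtain ⟨u, rfl⟩ := (mem_translationGroup_hessePoints hρ _).mp hφ
    refine (mem_translationGroup_hessePoints hσ _).mpr ⟨u, ?_⟩
    rw [pglMap_mk]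
    congr 1
    refine Matrix.GeneralLinearGroup.ext fun i j => ?_
    change σ (heisMatrix ρ u i j) = heisMatrix (σ ρ) u i j
    simp only [heisMatrix, Matrix.of_apply, chi]
    split_ifs <;> simp
  refine le_antisymm (hle σ) fun φ hφ => ?_
  refine ⟨pglMap ((σ⁻¹ : Gal(K/F)) : K ≃+* K).mapMatrix φ, hle σ⁻¹ ⟨φ, hφ, rfl⟩, ?_⟩
  induction φ using ProjGenLinGroup.induction_on with
  | mk g =>
    rw [pglMap_mk, pglMap_mk]
    congr 1
    exact Matrix.GeneralLinearGroup.ext fun i j => σ.apply_symm_apply (g.1 i j)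

theorem translationGroup_planeMap_image {ρ : K} (hρ : IsPrimitiveRoot ρ 3) (σ : Gal(K/F))
    (φ : PGL(3, K)) :
    translationGroup (planeMap σ '' (φ • hessePoints K)) =
      (translationGroup (φ • hessePoints K)).map (pglMap (σ : K ≃+* K).mapMatrix) := by
  rw [planeMap_image_smul, planeMap_image_hessePoints, translationGroup_smul,
    translationGroup_smul]
  conv_lhs => rw [← map_pglMap_translationGroup_hessePoints hρ σ]
  rw [Subgroup.map_map, Subgroup.map_map]
  congr 1
  ext ψ
  simp

theorem pglMap_eq_conj {σ : Gal(K/F)}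
    {τ : Matrix (Fin 3) (Fin 3) K ≃+* Matrix (Fin 3) (Fin 3) K} {h : GL (Fin 3) K}
    (hτ : ∀ M, τ M = h.1 * (σ : K ≃+* K).mapMatrix M * (h⁻¹).1) :
    pglMap τ = (MulAut.conj (ProjGenLinGroup.mk h)).toMonoidHom.comp
      (pglMap (σ : K ≃+* K).mapMatrix) := by
  ext φ
  induction φ using ProjGenLinGroup.induction_on with
  | mk g =>
    rw [MonoidHom.comp_apply, pglMap_mk, pglMap_mk]
    change _ = ProjGenLinGroup.mk h * _ * (ProjGenLinGroup.mk h)⁻¹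
    rw [← map_inv, ← map_mul, ← map_mul]
    congr 1
    exact Units.ext (hτ g.1)

theorem rightIdeal_injective : Function.Injective (rightIdeal (K := K)) := by
  intro P Q h
  induction P using Projectivization.ind with
  | h v hv =>
    induction Q using Projectivization.ind with
    | h w hw =>
      have hm : Matrix.vecMulVec v (Pi.single 0 1) ∈ rightIdeal (Projectivization.mk K v hv) := by
        intro x
        rw [Projectivization.submodule_mk, Submodule.mem_span_singleton, Matrix.vecMulVec_mulVec]
        exact ⟨_, (op_smul_eq_smul _ _).symm⟩
      rw [h] at hm
      have := hm (Pi.single 0 1)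
      rw [Projectivization.submodule_mk, Submodule.mem_span_singleton,
        Matrix.vecMulVec_mulVec] at this
      obtain ⟨c, hc⟩ := this
      rw [Projectivization.mk_eq_mk_iff']
      exact ⟨c, by rw [hc]; simp⟩

/-- The matrix `τ M` sends `h σ(x)` to `h σ(M x)`, so ranges of matrices are moved by `σ` and then
by `h`. -/
theorem rightIdeal_smul_planeMap {σ : Gal(K/F)}
    {τ : Matrix (Fin 3) (Fin 3) K ≃+* Matrix (Fin 3) (Fin 3) K} {h : GL (Fin 3) K}
    (hτ : ∀ M, τ M = h.1 * (σ : K ≃+* K).mapMatrix M * (h⁻¹).1) (P : Plane K) :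
    rightIdeal (ProjGenLinGroup.mk h • planeMap σ P) = τ '' rightIdeal P := by
  have hmem (M : Matrix (Fin 3) (Fin 3) K) :
      τ M ∈ rightIdeal (ProjGenLinGroup.mk h • planeMap σ P) ↔ M ∈ rightIdeal P := by
    induction P using Projectivization.ind with
    | h v hv =>
      rw [planeMap_mk σ hv (comp_ne_zero σ hv), Projectivization.PGL.mk_smul_mk]
      simp only [rightIdeal, Set.mem_ofPred_eq, Projectivization.submodule_mk,
        Submodule.mem_span_singleton]
      let ε : (Fin 3 → K) ≃ (Fin 3 → K) :=
        (Equiv.piCongrRight fun _ => σ.toEquiv).trans (MulAction.toPerm h)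
      rw [← ε.forall_congr_right]
      refine forall_congr' fun x => ?_
      rw [← (σ.toEquiv).exists_congr_right]
      refine exists_congr fun c => ?_
      have e1 : (τ M).mulVec (ε x) = h • (fun i => σ (M.mulVec x i)) := by
        have : ε x = h.1.mulVec (fun i => σ (x i)) := rfl
        rw [hτ, this, Matrix.mulVec_mulVec, mul_assoc, ← Units.val_mul, inv_mul_cancel,
          Units.val_one, mul_one, ← Matrix.mulVec_mulVec]
        exact congrArg (h • ·) (funext fun i =>
          (RingHom.map_mulVec (σ : K →+* K) M x i).symm : _ = fun i => σ (M.mulVec x i))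
      have e2 : σ.toEquiv c • h • (fun i => σ (v i)) = h • (fun i => σ ((c • v) i)) := by
        rw [smul_comm]
        congr 1
        ext i
        simp
      rw [e1, e2, smul_left_cancel_iff, funext_iff, funext_iff]
      exact forall_congr' fun i => σ.injective.eq_iff
  ext M
  constructor
  · intro hM
    obtain ⟨N, rfl⟩ := τ.surjective M
    exact ⟨N, (hmem N).mp hM, rfl⟩
  · rintro ⟨N, hN, rfl⟩
    exact (hmem N).mpr hN

theorem idealImage_eq {σ : Gal(K/F)}
    {τ : Matrix (Fin 3) (Fin 3) K ≃+* Matrix (Fin 3) (Fin 3) K} {h : GL (Fin 3) K}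
    (hτ : ∀ M, τ M = h.1 * (σ : K ≃+* K).mapMatrix M * (h⁻¹).1) (I : Set (Plane K)) :
    idealImage τ I = ProjGenLinGroup.mk h • planeMap σ '' I := by
  ext Q
  constructor
  · rintro ⟨P, hP, hQ⟩
    rw [← rightIdeal_smul_planeMap hτ] at hQ
    rw [rightIdeal_injective hQ]
    exact Set.smul_mem_smul_set ⟨P, hP, rfl⟩
  · rintro ⟨_, ⟨P, hP, rfl⟩, rfl⟩
    exact ⟨P, hP, rightIdeal_smul_planeMap hτ P⟩

end

end InflectionSets

theorem mainTheorem8 {F K A : Type*} [Field F] [Field K] [Algebra F K] [IsSepClosure F K]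
    (h2 : (2 : F) ≠ 0) (h3 : (3 : F) ≠ 0) (ρ : K) (hρ : IsPrimitiveRoot ρ 3)
    [Ring A] [Algebra F A] (θ : K ⊗[F] A ≃ₐ[K] Matrix (Fin 3) (Fin 3) K) :
    -- the map `I ↦ S` is a bijection
    Set.BijOn InflectionSets.translationGroup (InflectionSets.inflectionSets K)
      (InflectionSets.heisenbergSubgroups ρ) ∧
    -- the inverse map `S ↦ I`, in terms of any two generators of `S`
    (∀ I ∈ InflectionSets.inflectionSets K, ∀ x y : PGL(3, K),
      Subgroup.closure {x, y} = InflectionSets.translationGroup I →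
        I = InflectionSets.onInvariantLine x ∩ InflectionSets.onInvariantLine y) ∧
    -- compatibility with the coordinatewise Galois action
    (∀ σ : Gal(K/F),
      (∀ I ∈ InflectionSets.inflectionSets K,
        InflectionSets.planeMap σ '' I ∈ InflectionSets.inflectionSets K ∧
        InflectionSets.translationGroup (InflectionSets.planeMap σ '' I) =
          (InflectionSets.translationGroup I).map
            (InflectionSets.pglMap (σ : K ≃+* K).mapMatrix)) ∧
      (∀ S ∈ InflectionSets.heisenbergSubgroups ρ,
        S.map (InflectionSets.pglMap (σ : K ≃+* K).mapMatrix) ∈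
          InflectionSets.heisenbergSubgroups ρ)) ∧
    -- compatibility with the Galois action coming from a central simple algebra `A` of degree three
    (∀ σ : Gal(K/F),
      (∀ I ∈ InflectionSets.inflectionSets K,
        InflectionSets.idealImage (InflectionSets.twist θ σ) I ∈
          InflectionSets.inflectionSets K ∧
        InflectionSets.translationGroup
            (InflectionSets.idealImage (InflectionSets.twist θ σ) I) =
          (InflectionSets.translationGroup I).map
            (InflectionSets.pglMap (InflectionSets.twist θ σ))) ∧
      (∀ S ∈ InflectionSets.heisenbergSubgroups ρ,
        S.map (InflectionSets.pglMap (InflectionSets.twist θ σ)) ∈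
          InflectionSets.heisenbergSubgroups ρ)) ∧
    -- the stabilizer of `I` is the normalizer of `S`
    (∀ I ∈ InflectionSets.inflectionSets K,
      MulAction.stabilizer PGL(3, K) I =
        Subgroup.normalizer (InflectionSets.translationGroup I : Set PGL(3, K))) := by
  have := IsSepClosure.sep_closed (k := F) (K := K)
  have h2' : (2 : K) ≠ 0 := by
    rw [← map_ofNat (algebraMap F K)]
    exact (map_ne_zero _).mpr h2
  -- Both Galois actions have this shape: `h = 1` gives the coordinatewise one, and Skolem–Noether
  -- supplies `h` for the twisted one.
  have twisted (σ : Gal(K/F)) (τ : Matrix (Fin 3) (Fin 3) K ≃+* Matrix (Fin 3) (Fin 3) K)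
      (h : GL (Fin 3) K) (hτ : ∀ M, τ M = h.1 * (σ : K ≃+* K).mapMatrix M * (h⁻¹).1) :
      (∀ I ∈ InflectionSets.inflectionSets K,
        InflectionSets.idealImage τ I ∈ InflectionSets.inflectionSets K ∧
        InflectionSets.translationGroup (InflectionSets.idealImage τ I) =
          (InflectionSets.translationGroup I).map (InflectionSets.pglMap τ)) ∧
      (∀ S ∈ InflectionSets.heisenbergSubgroups ρ,
        S.map (InflectionSets.pglMap τ) ∈ InflectionSets.heisenbergSubgroups ρ) := by
    have hmap (φ : PGL(3, K)) :
        InflectionSets.translationGroup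
            (InflectionSets.idealImage τ (φ • InflectionSets.hessePoints K)) =
          (InflectionSets.translationGroup (φ • InflectionSets.hessePoints K)).map
            (InflectionSets.pglMap τ) := by
      rw [InflectionSets.idealImage_eq hτ, InflectionSets.translationGroup_smul,
        InflectionSets.translationGroup_planeMap_image hρ, Subgroup.map_map,
        InflectionSets.pglMap_eq_conj hτ]
    have himage (φ : PGL(3, K)) : ∃ ψ : PGL(3, K),
        InflectionSets.idealImage τ (φ • InflectionSets.hessePoints K) =
          ψ • InflectionSets.hessePoints K :=
      ⟨_, by rw [InflectionSets.idealImage_eq hτ, InflectionSets.planeMap_image_smul,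
        InflectionSets.planeMap_image_hessePoints, smul_smul]⟩
    refine ⟨fun I hI => ?_, fun S hS => ?_⟩
    · obtain ⟨φ, rfl⟩ := InflectionSets.exists_eq_smul_hessePoints h2' hρ hI
      refine ⟨?_, hmap φ⟩
      obtain ⟨ψ, hψ⟩ := himage φ
      rw [hψ]
      exact InflectionSets.smul_mem_inflectionSets ψ
        (InflectionSets.hessePoints_mem_inflectionSets hρ)
    · obtain ⟨φ, rfl⟩ := (InflectionSets.mem_heisenbergSubgroups_iff hρ S).mp hS
      obtain ⟨ψ, hψ⟩ := himage φ
      exact (InflectionSets.mem_heisenbergSubgroups_iff hρ _).mpr ⟨ψ, by rw [← hmap, hψ]⟩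
  refine ⟨⟨?_, ?_, ?_⟩, ?_, fun σ => ?_, fun σ => ?_, ?_⟩
  · intro I hI
    obtain ⟨φ, rfl⟩ := InflectionSets.exists_eq_smul_hessePoints h2' hρ hI
    exact (InflectionSets.mem_heisenbergSubgroups_iff hρ _).mpr ⟨φ, rfl⟩
  · intro I hI J hJ h
    obtain ⟨φ, rfl⟩ := InflectionSets.exists_eq_smul_hessePoints h2' hρ hI
    obtain ⟨ψ, rfl⟩ := InflectionSets.exists_eq_smul_hessePoints h2' hρ hJ
    exact InflectionSets.eq_of_translationGroup_eq hρ h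
  · intro S hS
    obtain ⟨φ, rfl⟩ := (InflectionSets.mem_heisenbergSubgroups_iff hρ S).mp hS
    exact ⟨_, InflectionSets.smul_mem_inflectionSets φ
      (InflectionSets.hessePoints_mem_inflectionSets hρ), rfl⟩
  · intro I hI x y h
    obtain ⟨φ, rfl⟩ := InflectionSets.exists_eq_smul_hessePoints h2' hρ hI
    exact InflectionSets.eq_onInvariantLine_inter hρ φ h
  · have hτ (M : Matrix (Fin 3) (Fin 3) K) : (σ : K ≃+* K).mapMatrix M =
        (1 : GL (Fin 3) K).1 * (σ : K ≃+* K).mapMatrix M * ((1 : GL (Fin 3) K)⁻¹).1 := by simp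
    have h := twisted σ (σ : K ≃+* K).mapMatrix 1 hτ
    simp only [InflectionSets.idealImage_eq hτ, map_one, one_smul] at h
    exact h
  · obtain ⟨h, hτ⟩ := InflectionSets.exists_eq_conj_mapMatrix σ _ (InflectionSets.twist_smul θ σ)
    exact twisted σ _ h hτ
  · intro I hI
    obtain ⟨φ, rfl⟩ := InflectionSets.exists_eq_smul_hessePoints h2' hρ hI
    exact InflectionSets.stabilizer_eq_normalizer hρ φ
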